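/- Let $n\ge 1$ and $m\ge 1$ be integers and $N=\left[\frac n2\right]+\left[\frac m2\right]+1$. For real polynomials $f$, $g$ and a real parameter $\varepsilon$ consider the discontinuous planar system $$\dot x=y,\qquad \dot y=-x-\varepsilon\,\bigl(f(x)\,y+\operatorname{sgn}(y)\,g(x)\bigr). \tag{1}$$ Its smooth pieces, on $y>0$ and on $y<0$, are $X(x,y)=(y,\,-x-\varepsilon(f(x)y+g(x)))$ and $Y(x,y)=(y,\,-x-\varepsilon(f(x)y-g(x)))$. A trajectory of (1) is a continuous curve that satisfies (1) off the line $y=0$ and meets this line only at isolated times and only at crossing points, i.e. points where the second components of $X$ and $Y$ have positive product. A limit cycle is a periodic orbit (the image of a periodic trajectory) that has a neighbourhood which no other periodic orbit meets. The number of limit cycles of (1) bifurcating from the periodic orbits of the linear center $\dot x=y$, $\dot y=-x$ is the supremum over $0<a<b$ of $\liminf_{\varepsilon\to0,\ \varepsilon\ne0}$ of the number of limit cycles of (1) contained in the annulus $a^2\le x^2+y^2\le b^2$. The first-order averaged function of (1) is $$F_0(r)=\frac1{2\pi}\int_0^{2\pi}\sin\theta\,\bigl(f(r\cos\theta)\,r\sin\theta+\operatorname{sgn}(r\sin\theta)\,g(r\cos\theta)\bigr)\,d\theta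 .$$ Then: 1. $N$ is a lower bound for the maximum number (the supremum over all real polynomials $f$ of degree $n$ and $g$ of degree $m$) of limit cycles of (1) bifurcating from the periodic orbits of the linear center. 2. There are real polynomials $f$ of degree $n$ and $g$ of degree $m$ for which exactly $N$ limit cycles bifurcate from the periodic orbits of the linear center: $F_0$ has exactly $N$ positive zeros $r_1<\dots<r_N$, all of them simple, and there are families $\Gamma_1(\varepsilon),\dots,\Gamma_N(\varepsilon)$ of subsets of the plane such that $\Gamma_i(\varepsilon)$ tends, in the Hausdorff distance, to the circle $x^2+y^2=r_i^2$ as $\varepsilon\to0$, and, for all $0<a<r_1$ and $b>r_N$ and for all $\varepsilon\neq0$ with $|\varepsilon|$ sufficiently small (depending on $a,b$), the sets $\Gamma_1(\varepsilon),\dots,\Gamma_N(\varepsilon)$ are pairwise distinct and are precisely the limit cycles of (1) contained in the annulus $a^2\le x^2+y^2\le b^2$. 3. $N$ is the largest number obtainable by first-order averaging: for all real polynomials $f$ of degree $n$ and $g$ of degree $m$, if $F_0$ does not vanish identically on $(0,\infty)$, then $F_0$ has at most $N$ positive zeros. -/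

import Mathlib

open Filter Topology Polynomial

noncomputable section

namespace Lienard

/-- The discontinuous vector field `(x, y) ↦ (y, -x - ε (f(x) y + sgn(y) g(x)))`. -/
def field (f g : ℝ[X]) (ε : ℝ) (p : ℝ × ℝ) : ℝ × ℝ :=
  (p.2, -p.1 - ε * (f.eval p.1 * p.2 + Real.sign p.2 * g.eval p.1))

/-- The smooth piece of the system that governs the half plane `y > 0`. -/
def upperField (f g : ℝ[X]) (ε : ℝ) (p : ℝ × ℝ) : ℝ × ℝ :=
  (p.2, -p.1 - ε * (f.eval p.1 * p.2 + g.eval p.1))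

/-- The smooth piece of the system that governs the half plane `y < 0`. -/
def lowerField (f g : ℝ[X]) (ε : ℝ) (p : ℝ × ℝ) : ℝ × ℝ :=
  (p.2, -p.1 - ε * (f.eval p.1 * p.2 - g.eval p.1))

/-- The crossing region of the discontinuity line `y = 0`: the Lie derivatives of
`h(x, y) = y` along the two smooth pieces are nonzero and have the same sign. -/
def crossingRegion (f g : ℝ[X]) (ε : ℝ) : Set (ℝ × ℝ) :=
  {p | p.2 = 0 ∧ 0 < (upperField f g ε p).2 * (lowerField f g ε p).2}

/-- A trajectory, defined for all times, obtained by matching trajectories of the two smooth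
pieces at crossing points: a continuous curve that satisfies the equation off the line `y = 0`
and meets this line only at isolated times and only in the crossing region. -/
structure IsTrajectory (f g : ℝ[X]) (ε : ℝ) (γ : ℝ → ℝ × ℝ) : Prop where
  continuous : Continuous γ
  hasDerivAt : ∀ t, (γ t).2 ≠ 0 → HasDerivAt γ (field f g ε (γ t)) t
  crossing : ∀ t, (γ t).2 = 0 → γ t ∈ crossingRegion f g ε
  isolated : ∀ t, (γ t).2 = 0 → ∀ᶠ s in 𝓝[≠] t, (γ s).2 ≠ 0

/-- A periodic orbit, as a subset of the plane. (Trajectories as above are never constant.) -/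
def IsPeriodicOrbit (f g : ℝ[X]) (ε : ℝ) (Γ : Set (ℝ × ℝ)) : Prop :=
  ∃ γ : ℝ → ℝ × ℝ, IsTrajectory f g ε γ ∧ (∃ T : ℝ, 0 < T ∧ Function.Periodic γ T) ∧
    Γ = Set.range γ

/-- A limit cycle: a periodic orbit that has a neighbourhood which no other periodic orbit
meets. -/
def IsLimitCycle (f g : ℝ[X]) (ε : ℝ) (Γ : Set (ℝ × ℝ)) : Prop :=
  IsPeriodicOrbit f g ε Γ ∧
    ∃ U : Set (ℝ × ℝ), IsOpen U ∧ Γ ⊆ U ∧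
      ∀ Γ' : Set (ℝ × ℝ), IsPeriodicOrbit f g ε Γ' → (Γ' ∩ U).Nonempty → Γ' = Γ

/-- The circle of radius `r` centred at the origin; for `r > 0` these are the periodic orbits of
the linear center `ẋ = y, ẏ = -x`. -/
def centerOrbit (r : ℝ) : Set (ℝ × ℝ) := {p | p.1 ^ 2 + p.2 ^ 2 = r ^ 2}

/-- The limit cycles contained in the closed annulus with radii `a` and `b`. -/
def limitCyclesIn (f g : ℝ[X]) (ε a b : ℝ) : Set (Set (ℝ × ℝ)) :=
  {Γ | IsLimitCycle f g ε Γ ∧ Γ ⊆ {p | a ^ 2 ≤ p.1 ^ 2 + p.2 ^ 2 ∧ p.1 ^ 2 + p.2 ^ 2 ≤ b ^ 2}}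

/-- The number of limit cycles bifurcating from the periodic orbits of the linear center:
the supremum, over the compact annuli filled with periodic orbits of the center, of the number of
limit cycles that the annulus contains for all nonzero `ε` close to `0`. -/
def bifurcationNumber (f g : ℝ[X]) : ℕ∞ :=
  ⨆ (a : ℝ) (b : ℝ) (_ : 0 < a) (_ : a < b),
    liminf (fun ε : ℝ => (limitCyclesIn f g ε a b).encard) (𝓝[≠] 0)

/-- The maximum of the number of bifurcating limit cycles over all systems with `deg f = n` and
`deg g = m`. -/
def maxBifurcationNumber (n m : ℕ) : ℕ∞ :=
  ⨆ (f : ℝ[X]) (g : ℝ[X]) (_ : f.natDegree = n) (_ : g.natDegree = m), bifurcationNumber f g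

/-- Exactly `k` limit cycles bifurcate from the periodic orbits of the linear center, and they
bifurcate from the circles of radii `r 0, …, r (k - 1)`: there are `k` families of limit cycles
tending to these circles as `ε → 0`, and in every compact annulus that contains the circles in its
interior they are, for small `ε ≠ 0`, pairwise distinct and the only limit cycles. -/
def BifurcateExactlyFrom (f g : ℝ[X]) {k : ℕ} (r : Fin k → ℝ) : Prop :=
  StrictMono r ∧ (∀ i, 0 < r i) ∧
    ∃ Γ : ℝ → Fin k → Set (ℝ × ℝ),
      (∀ i, Tendsto (fun ε => Metric.hausdorffEDist (Γ ε i) (centerOrbit (r i)))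
        (𝓝[≠] 0) (𝓝 0)) ∧
      ∀ a b : ℝ, 0 < a → a < b → (∀ i, a < r i ∧ r i < b) →
        ∀ᶠ ε in 𝓝[≠] (0 : ℝ),
          Function.Injective (Γ ε) ∧ limitCyclesIn f g ε a b = Set.range (Γ ε)

/-- The first-order averaged function of the system in polar coordinates, with the polar angle as
independent variable. -/
def averagedFunction (f g : ℝ[X]) (r : ℝ) : ℝ :=
  1 / (2 * Real.pi) * ∫ θ in (0 : ℝ)..(2 * Real.pi),
    Real.sin θ * (f.eval (r * Real.cos θ) * (r * Real.sin θ) +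
      Real.sign (r * Real.sin θ) * g.eval (r * Real.cos θ))

/-- The positive zeros of the averaged function. -/
def averagedZeros (f g : ℝ[X]) : Set ℝ := {r | 0 < r ∧ averagedFunction f g r = 0}

end Lienard

end

/-! ### Sparse polynomials: Descartes' rule and prescribed positive roots. -/

noncomputable section

namespace Lienard

/-! Counting zeros. For `r > 0` the averaged function is a polynomial in `r`. The means of `sin²
cos^i` and `|sin| cos^j` vanish for odd exponents and are positive for even ones, so `f` contributes
the odd powers `r^(i+1)` with `i ≤ n` even, and `g` the even powers `r^j` with `j ≤ m` even. These
are `N + 1` monomials. By Descartes' rule a nonzero combination has at most `N` positive roots with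
multiplicity. Conversely, linear algebra gives a nonzero combination vanishing at `N` chosen points;
Descartes then forces all coefficients to be nonzero and the roots to be simple and the only
positive ones (`exists_support_eq_roots_simple`).

From zeros to cycles. In polar coordinates the system becomes `dr/dθ = ε S(θ, r, ε)`, where `S` is
smooth in `r` but jumps in `θ`, and the mean of `S(·, r, 0)` is the averaged function. No Poincaré
map is used. Instead, for each `c` near a radius `r₀` a contraction produces a closed curve `r =
R_c(θ)` with `R_c(0) = c` and `R_c' = ε (S - m(c))`, where `m(c)` is the mean of `S` along the curve
(`exists_curveFamily`). If `m(c) = 0`, the curve is a periodic orbit (`isPeriodicOrbit_polarCurve`).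
If `m(c) ≠ 0`, trajectories cross it in one direction only, so no periodic trajectory meets it
(`radialOffset_ne_zero`).

The curves sweep out a neighbourhood of the circle `r = r₀`, and `m` is close to the averaged
function, with difference quotients close to its derivative at `r₀`. Hence there are no periodic
orbits near a circle where the averaged function is nonzero, and exactly one near a simple zero.
Compactness of `[a, b]` glues these local statements into the exact list of limit cycles in an
annulus (`bifurcateExactlyFrom_of_simple_zeros`). -/

/-- Induction on the number of terms: deleting the leading term loses at most one sign variation,
and a monomial has none. -/
theorem signVariations_lt_card_support {P : ℝ[X]} (hP : P ≠ 0) :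
    P.signVariations < P.support.card := by
  induction h : P.support.card generalizing P with
  | zero => simp_all
  | succ k ih =>
    by_cases h0 : P.eraseLead = 0
    · have hs := P.eraseLead_add_monomial_natDegree_leadingCoeff
      rw [h0, zero_add] at hs
      rw [← hs, signVariations_monomial]
      omega
    · have h1 := ih h0 (card_support_eraseLead' h)
      have h2 := P.signVariations_le_eraseLead_succ
      omega

theorem card_roots_pos_lt_card_support {P : ℝ[X]} (hP : P ≠ 0) :
    P.roots.countP (0 < ·) < P.support.card :=
  (Polynomial.roots_countP_pos_le_signVariations P).trans_lt (signVariations_lt_card_support hP)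

/-- A nonzero polynomial supported on a finite set of exponents and vanishing at
prescribed points exists as soon as there are more exponents than points. -/
theorem exists_ne_zero_eval_eq_zero_of_card_lt (E : Finset ℕ) {N : ℕ} (hE : N < E.card)
    (x : Fin N → ℝ) : ∃ P : ℝ[X], P ≠ 0 ∧ P.support ⊆ E ∧ ∀ i, P.eval (x i) = 0 := by
  -- Coefficients are sent to values at the points; the kernel is nontrivial by dimension.
  let φ : (E → ℝ) →ₗ[ℝ] (Fin N → ℝ) :=
    { toFun := fun a i => ∑ e, a e * x i ^ (e : ℕ)
      map_add' := by
        intro a b; ext i; simp [add_mul, Finset.sum_add_distrib]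
      map_smul' := by
        intro c a; ext i; simp [Finset.mul_sum, mul_assoc] }
  have hker : LinearMap.ker φ ≠ ⊥ := by
    apply LinearMap.ker_ne_bot_of_finrank_lt
    simpa using hE
  obtain ⟨a, ha, ha0⟩ := (Submodule.ne_bot_iff _).1 hker
  have hcoeff : ∀ e : E, (∑ e : E, monomial (e : ℕ) (a e)).coeff e = a e := by
    intro e
    simp [Polynomial.coeff_monomial]
  refine ⟨∑ e : E, monomial (e : ℕ) (a e), ?_, ?_, ?_⟩
  · intro h
    apply ha0
    ext e
    rw [← hcoeff e, h]; simp
  · intro k hk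
    by_contra hkE
    rw [Polynomial.mem_support_iff] at hk
    apply hk
    rw [Polynomial.finsetSum_coeff]
    refine Finset.sum_eq_zero fun e _ => ?_
    rw [Polynomial.coeff_monomial, if_neg]
    rintro rfl
    exact hkE e.2
  · intro i
    have := congrFun (LinearMap.mem_ker.1 ha) i
    simpa [Polynomial.eval_finsetSum, φ] using this

/-- With one exponent more than prescribed positive roots, the polynomial has all its coefficients
nonzero and no other positive roots, and its positive roots are simple. -/
theorem exists_support_eq_roots_simple (E : Finset ℕ) {N : ℕ} (hE : E.card = N + 1)
    (x : Fin N → ℝ) (hx : ∀ i, 0 < x i) (hinj : Function.Injective x) :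
    ∃ P : ℝ[X], P.support = E ∧ (∀ r, 0 < r → (P.eval r = 0 ↔ r ∈ Set.range x)) ∧
      ∀ i, P.derivative.eval (x i) ≠ 0 := by
  obtain ⟨P, hP, hsupp, hroot⟩ := exists_ne_zero_eval_eq_zero_of_card_lt E (by omega) x
  -- Squeeze: `N` ≤ number of positive roots < number of terms ≤ `N + 1`. Equality throughout gives
  -- the full support, the absence of further roots, and simplicity at once.
  have hcard := card_roots_pos_lt_card_support hP
  have hle : (Multiset.map x Finset.univ.val) ≤ P.roots.filter (0 < ·) := by
    rw [Multiset.le_iff_subset (by simpa using Finset.univ.nodup.map hinj)]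
    intro r hr
    obtain ⟨i, -, rfl⟩ := Multiset.mem_map.1 hr
    simp [hP, hroot i, hx i]
  have h1 := Multiset.card_le_card hle
  have h2 := Finset.card_le_card hsupp
  rw [← Multiset.countP_eq_card_filter] at h1
  simp only [Multiset.card_map, Finset.card_val, Finset.card_univ, Fintype.card_fin] at h1
  have heq : (Multiset.map x Finset.univ.val) = P.roots.filter (0 < ·) := by
    apply Multiset.eq_of_le_of_card_le hle
    rw [← Multiset.countP_eq_card_filter]
    simp
    omega
  refine ⟨P, Finset.eq_of_subset_of_card_le hsupp (by omega), ?_, ?_⟩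
  · intro r hr
    constructor
    · intro h
      have : r ∈ P.roots.filter (0 < ·) := by simp [hP, h, hr]
      rw [← heq] at this
      simpa using this
    · rintro ⟨i, rfl⟩
      exact hroot i
  · intro i h
    have h1 : 1 < P.rootMultiplicity (x i) :=
      (Polynomial.one_lt_rootMultiplicity_iff_isRoot hP).2 ⟨hroot i, h⟩
    rw [← Polynomial.count_roots] at h1
    have h3 : (P.roots.filter (0 < ·)).count (x i) = P.roots.count (x i) :=
      Multiset.count_filter_of_pos (hx i)
    have h4 : (Multiset.map x Finset.univ.val).count (x i) ≤ 1 :=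
      Multiset.nodup_iff_count_le_one.1 (by simpa using Finset.univ.nodup.map hinj) _
    rw [heq, h3] at h4
    omega

/-! ### The averaged function as a sparse polynomial. -/

/-- The mean value of `sin² cos^i`. -/
def sinSqMoment (i : ℕ) : ℝ :=
  1 / (2 * Real.pi) * ∫ θ in (0 : ℝ)..(2 * Real.pi), Real.sin θ ^ 2 * Real.cos θ ^ i

/-- The mean value of `|sin| cos^j`. -/
def absSinMoment (j : ℕ) : ℝ :=
  1 / (2 * Real.pi) * ∫ θ in (0 : ℝ)..(2 * Real.pi), |Real.sin θ| * Real.cos θ ^ j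

/-- Translation by `π` preserves the integral over a full period and also changes its sign. -/
theorem integral_eq_zero_of_antiperiodic {q : ℝ → ℝ} (hq : Function.Antiperiodic q Real.pi) :
    ∫ θ in (0 : ℝ)..(2 * Real.pi), q θ = 0 := by
  have hp : Function.Periodic q (2 * Real.pi) := hq.periodic_two_mul
  have h1 := hp.intervalIntegral_add_eq Real.pi 0
  have h2 : ∫ θ in (0 : ℝ)..(2 * Real.pi), q (θ + Real.pi)
      = ∫ θ in (Real.pi)..(Real.pi + 2 * Real.pi), q θ := by
    rw [intervalIntegral.integral_comp_add_right]
    congr 1 <;> ring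
  simp only [hq _, intervalIntegral.integral_neg] at h2
  rw [h1, zero_add] at h2
  linarith

theorem sinSqMoment_of_odd {i : ℕ} (hi : Odd i) : sinSqMoment i = 0 := by
  rw [sinSqMoment, integral_eq_zero_of_antiperiodic, mul_zero]
  intro θ
  simp [Real.sin_add_pi, Real.cos_add_pi, hi.neg_pow]

theorem absSinMoment_of_odd {j : ℕ} (hj : Odd j) : absSinMoment j = 0 := by
  rw [absSinMoment, integral_eq_zero_of_antiperiodic, mul_zero]
  intro θ
  simp [Real.sin_add_pi, Real.cos_add_pi, hj.neg_pow]

theorem sinSqMoment_pos {i : ℕ} (hi : Even i) : 0 < sinSqMoment i := by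
  refine mul_pos (by positivity) (intervalIntegral.integral_pos (by positivity) (by fun_prop)
    (fun θ _ => mul_nonneg (sq_nonneg _) (hi.pow_nonneg _)) ⟨Real.pi / 4, ?_, ?_⟩)
  · constructor <;> linarith [Real.pi_pos]
  · rw [Real.sin_pi_div_four, Real.cos_pi_div_four]; positivity

theorem absSinMoment_pos {j : ℕ} (hj : Even j) : 0 < absSinMoment j := by
  refine mul_pos (by positivity) (intervalIntegral.integral_pos (by positivity) (by fun_prop)
    (fun θ _ => mul_nonneg (abs_nonneg _) (hj.pow_nonneg _)) ⟨Real.pi / 4, ?_, ?_⟩)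
  · constructor <;> linarith [Real.pi_pos]
  · rw [Real.sin_pi_div_four, Real.cos_pi_div_four]; positivity

/-- The polynomial that agrees with the averaged function at positive radii. -/
def averagedPolynomial (f g : ℝ[X]) : ℝ[X] :=
  ∑ i ∈ Finset.range (f.natDegree + 1), monomial (i + 1) (f.coeff i * sinSqMoment i) +
    ∑ j ∈ Finset.range (g.natDegree + 1), monomial j (g.coeff j * absSinMoment j)

theorem coeff_averagedPolynomial (f g : ℝ[X]) (k : ℕ) :
    (averagedPolynomial f g).coeff k =
      (if k = 0 then 0 else f.coeff (k - 1) * sinSqMoment (k - 1)) +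
        g.coeff k * absSinMoment k := by
  rw [averagedPolynomial, coeff_add, finsetSum_coeff, finsetSum_coeff]
  simp only [coeff_monomial]
  congr 1
  · rcases k with _ | k
    · simp
    · simp only [add_left_inj, Finset.sum_ite_eq', Finset.mem_range]
      split_ifs with h1 h2 h2
      · simp at h2
      · simp
      · simp
      · rw [add_tsub_cancel_right, coeff_eq_zero_of_natDegree_lt (by omega), zero_mul]
  · simp only [Finset.sum_ite_eq', Finset.mem_range]
    split_ifs with h1
    · rfl
    · rw [coeff_eq_zero_of_natDegree_lt (by omega), zero_mul]

/-- Positivity of `r` turns `sin θ · sgn(r sin θ)` into `|sin θ|`; the rest is term-by-term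
integration. -/
theorem averagedFunction_eq_eval (f g : ℝ[X]) {r : ℝ} (hr : 0 < r) :
    averagedFunction f g r = (averagedPolynomial f g).eval r := by
  have h1 : ∀ θ : ℝ, Real.sin θ * (f.eval (r * Real.cos θ) * (r * Real.sin θ) +
      Real.sign (r * Real.sin θ) * g.eval (r * Real.cos θ)) =
      ∑ i ∈ Finset.range (f.natDegree + 1),
        f.coeff i * r ^ (i + 1) * (Real.sin θ ^ 2 * Real.cos θ ^ i) +
      ∑ j ∈ Finset.range (g.natDegree + 1),
        g.coeff j * r ^ j * (|Real.sin θ| * Real.cos θ ^ j) := by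
    intro θ
    have hs : Real.sin θ * Real.sign (r * Real.sin θ) = |Real.sin θ| := by
      rcases lt_trichotomy (Real.sin θ) 0 with h | h | h
      · rw [Real.sign_of_neg (mul_neg_of_pos_of_neg hr h), abs_of_neg h]; ring
      · simp [h]
      · rw [Real.sign_of_pos (mul_pos hr h), abs_of_pos h]; ring
    rw [mul_add, ← mul_assoc (Real.sin θ) (Real.sign _), hs, eval_eq_sum_range,
      eval_eq_sum_range, Finset.sum_mul, Finset.mul_sum, Finset.mul_sum]
    congr 1 <;> refine Finset.sum_congr rfl fun i _ => ?_ <;> ring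
  rw [averagedFunction]
  simp_rw [h1]
  rw [intervalIntegral.integral_add, intervalIntegral.integral_finsetSum,
    intervalIntegral.integral_finsetSum, averagedPolynomial, eval_add, eval_finsetSum,
    eval_finsetSum, mul_add, Finset.mul_sum, Finset.mul_sum]
  · simp only [intervalIntegral.integral_const_mul, eval_monomial, sinSqMoment, absSinMoment]
    congr 1 <;> refine Finset.sum_congr rfl fun i _ => ?_ <;> ring
  all_goals intros; exact Continuous.intervalIntegrable (by fun_prop) _ _

/-- The exponents of the averaged polynomial for `deg f ≤ n` and `deg g ≤ m`. -/
def averagedExponents (n m : ℕ) : Finset ℕ :=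
  (Finset.range (n / 2 + 1)).image (fun i => 2 * i + 1) ∪
    (Finset.range (m / 2 + 1)).image (fun j => 2 * j)

theorem mem_averagedExponents {n m k : ℕ} :
    k ∈ averagedExponents n m ↔ (Odd k ∧ k ≤ n + 1) ∨ (Even k ∧ k ≤ m) := by
  simp only [averagedExponents, Finset.mem_union, Finset.mem_image, Finset.mem_range]
  refine or_congr ⟨?_, ?_⟩ ⟨?_, ?_⟩
  · rintro ⟨i, hi, rfl⟩; exact ⟨⟨i, rfl⟩, by omega⟩
  · rintro ⟨⟨i, rfl⟩, hi⟩; exact ⟨i, by omega, rfl⟩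
  · rintro ⟨i, hi, rfl⟩; exact ⟨even_two_mul i, by omega⟩
  · rintro ⟨⟨i, rfl⟩, hi⟩; exact ⟨i, by omega, by omega⟩

theorem card_averagedExponents (n m : ℕ) :
    (averagedExponents n m).card = n / 2 + m / 2 + 1 + 1 := by
  rw [averagedExponents, Finset.card_union_of_disjoint,
    Finset.card_image_of_injective _ (fun a b h => by simpa using h),
    Finset.card_image_of_injective _ (fun a b h => by simpa using h)]
  · simp; omega
  · rw [Finset.disjoint_left]
    simp only [Finset.mem_image]
    rintro _ ⟨i, -, rfl⟩ ⟨j, -, h⟩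
    omega

theorem support_averagedPolynomial_subset (f g : ℝ[X]) :
    (averagedPolynomial f g).support ⊆ averagedExponents f.natDegree g.natDegree := by
  intro k hk
  rw [mem_support_iff, coeff_averagedPolynomial] at hk
  rw [mem_averagedExponents]
  rcases Nat.even_or_odd k with he | ho
  · refine Or.inr ⟨he, ?_⟩
    by_contra hlt
    rw [coeff_eq_zero_of_natDegree_lt (p := g) (by omega), zero_mul, add_zero] at hk
    split_ifs at hk with h0
    · exact hk rfl
    · rw [sinSqMoment_of_odd (Nat.Even.sub_odd (by omega) he odd_one), mul_zero] at hk
      exact hk rfl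
  · refine Or.inl ⟨ho, ?_⟩
    by_contra hlt
    rw [absSinMoment_of_odd ho, coeff_eq_zero_of_natDegree_lt (p := f) (by omega)] at hk
    simp at hk

theorem encard_averagedZeros_le (f g : ℝ[X])
    (h : ∃ ρ : ℝ, 0 < ρ ∧ averagedFunction f g ρ ≠ 0) :
    (averagedZeros f g).encard ≤ ((f.natDegree / 2 + g.natDegree / 2 + 1 : ℕ) : ℕ∞) := by
  obtain ⟨ρ, hρ, hne⟩ := h
  have hP : averagedPolynomial f g ≠ 0 := by
    intro h0
    rw [averagedFunction_eq_eval f g hρ, h0, eval_zero] at hne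
    exact hne rfl
  have hsub : averagedZeros f g ⊆
      ((((averagedPolynomial f g).roots.filter (0 < ·)).toFinset : Finset ℝ) : Set ℝ) := by
    rintro r ⟨hr, h0⟩
    rw [averagedFunction_eq_eval f g hr] at h0
    simp [hP, h0, hr]
  refine (Set.encard_le_encard hsub).trans ?_
  rw [Set.encard_coe_eq_coe_finsetCard, Nat.cast_le]
  have h1 := card_roots_pos_lt_card_support hP
  have h2 := Finset.card_le_card (support_averagedPolynomial_subset f g)
  rw [card_averagedExponents] at h2
  rw [Multiset.countP_eq_card_filter] at h1
  exact (Multiset.toFinset_card_le _).trans (by omega)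

theorem natDegree_sum_monomial {n : ℕ} {a : ℕ → ℝ} (ha : a n ≠ 0) :
    (∑ i ∈ Finset.range (n + 1), monomial i (a i)).natDegree = n := by
  apply natDegree_eq_of_le_of_coeff_ne_zero
  · refine natDegree_sum_le_of_forall_le _ _ fun i hi => (natDegree_monomial_le _).trans ?_
    simpa [Nat.lt_succ_iff] using hi
  · simpa [coeff_monomial] using ha

/-- Dividing the coefficients of a polynomial with full support by the nonzero moments recovers `f`
and `g`. Full support matters for the degrees: it makes the leading coefficients nonzero when `n` or
`m` is even. -/
theorem exists_averagedZeros_eq (n m : ℕ) :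
    ∃ f g : ℝ[X], f.natDegree = n ∧ g.natDegree = m ∧ ∃ r : Fin (n / 2 + m / 2 + 1) → ℝ,
      StrictMono r ∧ (∀ i, 0 < r i) ∧ averagedZeros f g = Set.range r ∧
        ∀ i, deriv (averagedFunction f g) (r i) ≠ 0 := by
  -- Any distinct positive radii would do; these are `1, …, N`.
  obtain ⟨r, hr⟩ : ∃ r : Fin (n / 2 + m / 2 + 1) → ℝ, r = fun i => (i.val : ℝ) + 1 := ⟨_, rfl⟩
  have hmono : StrictMono r := by
    subst hr; intro i j hij
    simpa using hij
  have hpos : ∀ i, 0 < r i := by subst hr; intro i; positivity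
  obtain ⟨P, hsupp, hzero, hder⟩ := exists_support_eq_roots_simple (averagedExponents n m)
    (card_averagedExponents n m) r hpos hmono.injective
  have hmem : ∀ k, P.coeff k ≠ 0 ↔ (Odd k ∧ k ≤ n + 1) ∨ (Even k ∧ k ≤ m) := fun k => by
    rw [← mem_support_iff, hsupp, mem_averagedExponents]
  -- Odd-index coefficients do not affect the averaged function; the value `1` secures the exact
  -- degree when `n` or `m` is odd.
  let a : ℕ → ℝ := fun i => if Even i then P.coeff (i + 1) / sinSqMoment i else 1
  let b : ℕ → ℝ := fun j => if Even j then P.coeff j / absSinMoment j else 1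
  have ha : a n ≠ 0 := by
    by_cases h : Even n
    · simp only [a, if_pos h]
      exact div_ne_zero ((hmem _).2 (Or.inl ⟨h.add_one, le_rfl⟩)) (sinSqMoment_pos h).ne'
    · simp [a, h]
  have hb : b m ≠ 0 := by
    by_cases h : Even m
    · simp only [b, if_pos h]
      exact div_ne_zero ((hmem _).2 (Or.inr ⟨h, le_rfl⟩)) (absSinMoment_pos h).ne'
    · simp [b, h]
  let f : ℝ[X] := ∑ i ∈ Finset.range (n + 1), monomial i (a i)
  let g : ℝ[X] := ∑ j ∈ Finset.range (m + 1), monomial j (b j)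
  have hf : ∀ i, f.coeff i = if i < n + 1 then a i else 0 := by
    intro i; simp [f, finsetSum_coeff, coeff_monomial]
  have hg : ∀ i, g.coeff i = if i < m + 1 then b i else 0 := by
    intro i; simp [g, finsetSum_coeff, coeff_monomial]
  have hP : averagedPolynomial f g = P := by
    ext k
    rw [coeff_averagedPolynomial, hf, hg]
    rcases Nat.even_or_odd k with he | ho
    · have h1 : (if k = 0 then 0 else (if k - 1 < n + 1 then a (k - 1) else 0) *
          sinSqMoment (k - 1)) = 0 := by
        split_ifs with h0 h2
        · rfl
        · rw [sinSqMoment_of_odd (Nat.Even.sub_odd (by omega) he odd_one), mul_zero]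
        · rw [zero_mul]
      rw [h1, zero_add]
      by_cases hk : k < m + 1
      · simp only [if_pos hk, b, if_pos he]
        exact div_mul_cancel₀ _ (absSinMoment_pos he).ne'
      · rw [if_neg hk, zero_mul, eq_comm]
        by_contra hne
        rcases (hmem k).1 hne with h | h
        · exact (Nat.not_odd_iff_even.2 he) h.1
        · omega
    · obtain ⟨i, rfl⟩ := ho
      rw [absSinMoment_of_odd ⟨i, rfl⟩, mul_zero, add_zero, if_neg (by omega),
        add_tsub_cancel_right]
      by_cases hk : 2 * i < n + 1
      · simp only [if_pos hk, a, if_pos (even_two_mul i)]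
        exact div_mul_cancel₀ _ (sinSqMoment_pos (even_two_mul i)).ne'
      · rw [if_neg hk, zero_mul, eq_comm]
        by_contra hne
        rcases (hmem _).1 hne with h | h
        · omega
        · exact (Nat.not_odd_iff_even.2 h.1) ⟨i, rfl⟩
  refine ⟨f, g, natDegree_sum_monomial ha, natDegree_sum_monomial hb, r, hmono, hpos, ?_, ?_⟩
  · ext x
    constructor
    · rintro ⟨hx, h0⟩
      rw [averagedFunction_eq_eval f g hx, hP] at h0
      exact (hzero x hx).1 h0
    · intro hx
      have hx0 : 0 < x := by obtain ⟨i, rfl⟩ := hx; exact hpos i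
      refine ⟨hx0, ?_⟩
      rw [averagedFunction_eq_eval f g hx0, hP]
      exact (hzero x hx0).2 hx
  · intro i
    have h : averagedFunction f g =ᶠ[𝓝 (r i)] fun x => P.eval x := by
      filter_upwards [lt_mem_nhds (hpos i)] with x hx
      rw [averagedFunction_eq_eval f g hx, hP]
    rw [h.deriv_eq, Polynomial.deriv]
    exact hder i

end Lienard

end

/-! ### Monotonicity arguments for periodic functions of one variable. -/

namespace Lienard

/-- Near a point outside a discrete exceptional set, a function whose derivative is positive off
that set is strictly increasing through the point. -/
theorem eventually_lt_of_deriv_pos {u : ℝ → ℝ} {t : ℝ} (hu : ContinuousAt u t)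
    (hd : ∀ᶠ s in 𝓝[≠] t, ∃ u', 0 < u' ∧ HasDerivAt u u' s) :
    (∀ᶠ s in 𝓝[>] t, u t < u s) ∧ ∀ᶠ s in 𝓝[<] t, u s < u t := by
  rw [eventually_nhdsWithin_iff, Metric.eventually_nhds_iff] at hd
  obtain ⟨δ, hδ, hd⟩ := hd
  have hd' : ∀ s, |s - t| < δ → s ≠ t → ∃ u', 0 < u' ∧ HasDerivAt u u' s :=
    fun s h1 h2 => hd (by rwa [Real.dist_eq]) h2
  have hc : ∀ s, |s - t| < δ → ContinuousAt u s := by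
    intro s hs
    by_cases h : s = t
    · rwa [h]
    · obtain ⟨u', -, h'⟩ := hd' s hs h
      exact h'.continuousAt
  have hmono : ∀ p q, p < q → (∀ s ∈ Set.Icc p q, |s - t| < δ) → (∀ s ∈ Set.Ioo p q, s ≠ t) →
      u p < u q := by
    intro p q hpq h1 h2
    refine strictMonoOn_of_deriv_pos (convex_Icc p q)
      (fun s hs => (hc s (h1 s hs)).continuousWithinAt) (fun s hs => ?_)
      (Set.left_mem_Icc.2 hpq.le) (Set.right_mem_Icc.2 hpq.le) hpq
    rw [interior_Icc] at hs
    obtain ⟨u', hpos, h'⟩ := hd' s (h1 s (Set.Ioo_subset_Icc_self hs)) (h2 s hs)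
    rwa [h'.deriv]
  constructor
  · filter_upwards [Ioo_mem_nhdsGT (show t < t + δ by linarith)] with s hs
    refine hmono t s hs.1 (fun x hx => ?_) (fun x hx => hx.1.ne')
    rw [abs_lt]; constructor <;> linarith [hx.1, hx.2, hs.1, hs.2]
  · filter_upwards [Ioo_mem_nhdsLT (show t - δ < t by linarith)] with s hs
    refine hmono s t hs.2 (fun x hx => ?_) (fun x hx => hx.2.ne)
    rw [abs_lt]; constructor <;> linarith [hx.1, hx.2, hs.1, hs.2]

/-- A continuous periodic function which can only cross zero upwards has no zero. -/
theorem ne_zero_of_periodic_of_upcrossing {u : ℝ → ℝ} (hu : Continuous u) {T : ℝ} (hT : 0 < T)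
    (hper : Function.Periodic u T)
    (h : ∀ t, u t = 0 → (∀ᶠ s in 𝓝[>] t, 0 < u s) ∧ ∀ᶠ s in 𝓝[<] t, u s < 0) (t : ℝ) :
    u t ≠ 0 := by
  intro h0
  have hT0 : u (t + T) = 0 := by rw [hper, h0]
  obtain ⟨s, hs0, hst, hsT⟩ : ∃ s, 0 < u s ∧ t < s ∧ s < t + T :=
    ((h t h0).1.and (Ioo_mem_nhdsGT (show t < t + T by linarith))).exists
  -- At the first zero after `s` the function arrives from negative values, but it is positive at
  -- `s`; an earlier zero lies in between.
  let Z := Set.Icc s (t + T) ∩ {x | u x = 0}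
  have hZ : IsCompact Z := isCompact_Icc.inter_right (isClosed_eq hu continuous_const)
  have hZ0 : Z.Nonempty := ⟨t + T, ⟨hsT.le, le_rfl⟩, hT0⟩
  obtain ⟨z, ⟨⟨hsz, hzT⟩, hz0⟩, hmin⟩ := hZ.exists_isLeast hZ0
  have hsz' : s < z := lt_of_le_of_ne hsz (by rintro rfl; exact hs0.ne' hz0)
  obtain ⟨x, hx0, hsx, hxz⟩ : ∃ x, u x < 0 ∧ s < x ∧ x < z :=
    ((h z hz0).2.and (Ioo_mem_nhdsLT hsz')).exists
  obtain ⟨y, hy, hy0⟩ := intermediate_value_Icc' hsx.le hu.continuousOn ⟨hx0.le, hs0.le⟩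
  have := hmin ⟨⟨hy.1, by linarith [hy.2]⟩, hy0⟩
  linarith [hy.2]

/-- A continuous periodic function cannot be strictly increasing through every point. -/
theorem not_periodic_of_forall_eventually_lt {u : ℝ → ℝ} (hu : Continuous u) {T : ℝ} (hT : 0 < T)
    (hper : Function.Periodic u T) (h : ∀ t, ∀ᶠ s in 𝓝[>] t, u t < u s) : False := by
  -- A maximum over one period is a global maximum, so values cannot exceed it just to its right.
  obtain ⟨t, -, ht⟩ := isCompact_Icc.exists_isMaxOn (Set.nonempty_Icc.2 hT.le) hu.continuousOn
  obtain ⟨s, hs⟩ := (h t).exists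
  obtain ⟨x, hx, hxs⟩ := hper.exists_mem_Ico₀ hT s
  rw [hxs] at hs
  exact absurd (ht (Set.Ico_subset_Icc_self hx)) (not_le.2 hs)

end Lienard

/-! ### Closed curves from a contraction on periodic functions. -/

noncomputable section

namespace Lienard

instance : Fact (0 < 2 * Real.pi) := ⟨Real.two_pi_pos⟩

/-- The mean value of a `2π`-periodic function. -/
def circleMean (q : ℝ → ℝ) : ℝ := 1 / (2 * Real.pi) * ∫ s in (0 : ℝ)..(2 * Real.pi), q s

/-- The primitive vanishing at `0` of the oscillating part of a `2π`-periodic function. -/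
def oscPrimitive (q : ℝ → ℝ) (θ : ℝ) : ℝ := (∫ s in (0 : ℝ)..θ, q s) - θ * circleMean q

theorem abs_circleMean_le {q : ℝ → ℝ} {M : ℝ} (hM : ∀ s, |q s| ≤ M) : |circleMean q| ≤ M := by
  have h := intervalIntegral.norm_integral_le_of_norm_le_const (a := 0) (b := 2 * Real.pi)
    (f := q) (C := M) fun s _ => hM s
  have hp := Real.two_pi_pos
  rw [sub_zero, abs_of_pos hp, Real.norm_eq_abs] at h
  rw [circleMean, abs_mul, abs_of_pos (by positivity : 0 < 1 / (2 * Real.pi)), one_div,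
    inv_mul_le_iff₀ hp]
  linarith

theorem intervalIntegrable_of_abs_le {q : ℝ → ℝ} {M : ℝ} (hq : Measurable q)
    (hM : ∀ s, |q s| ≤ M) (a b : ℝ) : IntervalIntegrable q MeasureTheory.volume a b :=
  (intervalIntegrable_const (c := M)).mono_fun hq.aestronglyMeasurable
    (Eventually.of_forall fun s => (hM s).trans (le_abs_self M))

theorem circleMean_sub {p q : ℝ → ℝ}
    (hp : ∀ a b, IntervalIntegrable p MeasureTheory.volume a b)
    (hq : ∀ a b, IntervalIntegrable q MeasureTheory.volume a b) :
    circleMean (fun s => p s - q s) = circleMean p - circleMean q := by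
  rw [circleMean, intervalIntegral.integral_sub (hp _ _) (hq _ _), mul_sub]; rfl

theorem oscPrimitive_sub {p q : ℝ → ℝ}
    (hp : ∀ a b, IntervalIntegrable p MeasureTheory.volume a b)
    (hq : ∀ a b, IntervalIntegrable q MeasureTheory.volume a b) (θ : ℝ) :
    oscPrimitive (fun s => p s - q s) θ = oscPrimitive p θ - oscPrimitive q θ := by
  simp only [oscPrimitive]
  rw [circleMean_sub hp hq, intervalIntegral.integral_sub (hp _ _) (hq _ _)]; ring

theorem continuous_oscPrimitive {q : ℝ → ℝ}
    (hq : ∀ a b, IntervalIntegrable q MeasureTheory.volume a b) :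
    Continuous (oscPrimitive q) :=
  (intervalIntegral.continuous_primitive hq 0).sub (by fun_prop)

/-- Subtracting the mean cancels exactly the growth of the primitive over a period. -/
theorem periodic_oscPrimitive {q : ℝ → ℝ}
    (hq : ∀ a b, IntervalIntegrable q MeasureTheory.volume a b)
    (hper : Function.Periodic q (2 * Real.pi)) :
    Function.Periodic (oscPrimitive q) (2 * Real.pi) := by
  intro θ
  have h1 := intervalIntegral.integral_add_adjacent_intervals (hq 0 θ) (hq θ (θ + 2 * Real.pi))
  have h2 := hper.intervalIntegral_add_eq θ 0
  have hp := Real.pi_ne_zero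
  rw [zero_add] at h2
  rw [oscPrimitive, oscPrimitive, ← h1, h2, circleMean]
  field_simp
  ring

/-- By periodicity `θ` may be taken in `[0, 2π)`, where the integral and the subtracted mean term
contribute at most `2πM` each. -/
theorem abs_oscPrimitive_le {q : ℝ → ℝ} {M : ℝ} (hq : Measurable q) (hM : ∀ s, |q s| ≤ M)
    (hper : Function.Periodic q (2 * Real.pi)) (θ : ℝ) :
    |oscPrimitive q θ| ≤ 4 * Real.pi * M := by
  obtain ⟨x, hx, hxs⟩ := (periodic_oscPrimitive (intervalIntegrable_of_abs_le hq hM)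
    hper).exists_mem_Ico₀ Real.two_pi_pos θ
  rw [hxs]
  have h1 := intervalIntegral.norm_integral_le_of_norm_le_const (a := 0) (b := x)
    (f := q) (C := M) fun s _ => hM s
  have h2 := abs_circleMean_le hM
  have hM0 : 0 ≤ M := (abs_nonneg _).trans (hM 0)
  rw [sub_zero, abs_of_nonneg hx.1, Real.norm_eq_abs] at h1
  have h3 : |x * circleMean q| ≤ 2 * Real.pi * M := by
    rw [abs_mul, abs_of_nonneg hx.1]
    exact mul_le_mul hx.2.le h2 (abs_nonneg _) Real.two_pi_pos.le
  have h4 : M * x ≤ M * (2 * Real.pi) := mul_le_mul_of_nonneg_left hx.2.le hM0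
  calc _ ≤ |∫ s in (0 : ℝ)..x, q s| + |x * circleMean q| := abs_sub _ _
    _ ≤ _ := by linarith

theorem hasDerivAt_oscPrimitive {q : ℝ → ℝ} (hq : Measurable q)
    (hi : ∀ a b, IntervalIntegrable q MeasureTheory.volume a b) {θ : ℝ} (hc : ContinuousAt q θ) :
    HasDerivAt (oscPrimitive q) (q θ - circleMean q) θ := by
  have h1 := intervalIntegral.integral_hasDerivAt_right (hi 0 θ)
    hq.stronglyMeasurable.stronglyMeasurableAtFilter hc
  exact (h1.sub ((hasDerivAt_id θ).mul_const (circleMean q))).congr_deriv (by ring)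

/-- A bounded right-hand side `Q(θ, r)`, `2π`-periodic in `θ` and Lipschitz in `r`. -/
structure IsPeriodicLipschitz (Q : ℝ → ℝ → ℝ) (M L : ℝ) : Prop where
  periodic : ∀ θ r, Q (θ + 2 * Real.pi) r = Q θ r
  measurable : ∀ R : ℝ → ℝ, Continuous R → Measurable fun θ => Q θ (R θ)
  bound : ∀ θ r, |Q θ r| ≤ M
  lipschitz : ∀ θ u v, |Q θ u - Q θ v| ≤ L * |u - v|

namespace IsPeriodicLipschitz

variable {Q : ℝ → ℝ → ℝ} {M L : ℝ}

theorem measurable_comp (hQ : IsPeriodicLipschitz Q M L) (R : C(AddCircle (2 * Real.pi), ℝ)) :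
    Measurable fun θ : ℝ => Q θ (R θ) :=
  hQ.measurable _ (R.continuous.comp (AddCircle.continuous_mk' _))

theorem intervalIntegrable_comp (hQ : IsPeriodicLipschitz Q M L)
    (R : C(AddCircle (2 * Real.pi), ℝ)) (a b : ℝ) :
    IntervalIntegrable (fun θ : ℝ => Q θ (R θ)) MeasureTheory.volume a b :=
  intervalIntegrable_of_abs_le (hQ.measurable_comp R) (fun _ => hQ.bound _ _) a b

theorem periodic_comp (hQ : IsPeriodicLipschitz Q M L) (R : C(AddCircle (2 * Real.pi), ℝ)) :
    Function.Periodic (fun θ : ℝ => Q θ (R θ)) (2 * Real.pi) := by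
  intro θ
  simp only [AddCircle.coe_add_period, hQ.periodic]

theorem lipschitz_nonneg (hQ : IsPeriodicLipschitz Q M L) : 0 ≤ L := by
  simpa using (abs_nonneg _).trans (hQ.lipschitz 0 1 0)

/-- The integral operator whose fixed points are the periodic solutions of
`R' = ε (Q(θ, R) - m)`, `R(0) = c`, where `m` is the mean of `Q(θ, R(θ))`. -/
def operator (hQ : IsPeriodicLipschitz Q M L) (ε c : ℝ) (R : C(AddCircle (2 * Real.pi), ℝ)) :
    C(AddCircle (2 * Real.pi), ℝ) where
  toFun := (periodic_oscPrimitive (hQ.intervalIntegrable_comp R) (hQ.periodic_comp R)).comp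
    (fun y => c + ε * y) |>.lift
  continuous_toFun := by
    refine continuous_quot_lift _ ?_
    exact continuous_const.add
      (continuous_const.mul (continuous_oscPrimitive (hQ.intervalIntegrable_comp R)))

theorem operator_apply (hQ : IsPeriodicLipschitz Q M L) (ε c : ℝ)
    (R : C(AddCircle (2 * Real.pi), ℝ)) (θ : ℝ) :
    hQ.operator ε c R θ = c + ε * oscPrimitive (fun s => Q s (R s)) θ := rfl

theorem abs_oscPrimitive_sub_le (hQ : IsPeriodicLipschitz Q M L)
    (R S : C(AddCircle (2 * Real.pi), ℝ)) (θ : ℝ) :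
    |oscPrimitive (fun s => Q s (R s)) θ - oscPrimitive (fun s => Q s (S s)) θ| ≤
      4 * Real.pi * (L * ‖R - S‖) := by
  rw [← oscPrimitive_sub (hQ.intervalIntegrable_comp R) (hQ.intervalIntegrable_comp S)]
  refine abs_oscPrimitive_le ((hQ.measurable_comp R).sub (hQ.measurable_comp S)) (fun s => ?_)
    ((hQ.periodic_comp R).sub (hQ.periodic_comp S)) θ
  exact (hQ.lipschitz _ _ _).trans
    (mul_le_mul_of_nonneg_left ((R - S).norm_coe_le_norm s) hQ.lipschitz_nonneg)

theorem norm_operator_sub_le (hQ : IsPeriodicLipschitz Q M L) {ε : ℝ}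
    (hε : 8 * Real.pi * |ε| * L ≤ 1) (c : ℝ) (R S : C(AddCircle (2 * Real.pi), ℝ)) :
    ‖hQ.operator ε c R - hQ.operator ε c S‖ ≤ 1 / 2 * ‖R - S‖ := by
  rw [ContinuousMap.norm_le _ (by positivity)]
  intro x
  induction x using QuotientAddGroup.induction_on with
  | H θ =>
    change ‖hQ.operator ε c R (θ : AddCircle (2 * Real.pi)) - hQ.operator ε c S θ‖ ≤ _
    rw [operator_apply, operator_apply, add_sub_add_left_eq_sub, ← mul_sub, Real.norm_eq_abs,
      abs_mul]
    calc _ ≤ |ε| * (4 * Real.pi * (L * ‖R - S‖)) :=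
          mul_le_mul_of_nonneg_left (hQ.abs_oscPrimitive_sub_le R S θ) (abs_nonneg _)
      _ = (8 * Real.pi * |ε| * L) * (1 / 2 * ‖R - S‖) := by ring
      _ ≤ 1 * (1 / 2 * ‖R - S‖) := mul_le_mul_of_nonneg_right hε (by positivity)
      _ = _ := one_mul _

/-- Banach's fixed point theorem; the contraction constant is independent of `c`, so one smallness
condition on `ε` serves every starting value. -/
theorem exists_family (hQ : IsPeriodicLipschitz Q M L) {ε : ℝ}
    (hε : 8 * Real.pi * |ε| * L ≤ 1) :
    ∃ R : ℝ → C(AddCircle (2 * Real.pi), ℝ), ∀ c (θ : ℝ),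
      R c θ = c + ε * oscPrimitive (fun s => Q s (R c s)) θ := by
  have hcontr : ∀ c, ContractingWith (1 / 2) (hQ.operator ε c) := fun c =>
    ⟨by rw [← NNReal.coe_lt_coe]; norm_num, LipschitzWith.of_dist_le_mul fun R S => by
      rw [dist_eq_norm, dist_eq_norm]
      exact_mod_cast hQ.norm_operator_sub_le hε c R S⟩
  refine ⟨fun c => ContractingWith.fixedPoint _ (hcontr c), fun c θ => ?_⟩
  exact (congrArg (fun F : C(AddCircle (2 * Real.pi), ℝ) => F θ)
    (hcontr c).fixedPoint_isFixedPt).symm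

theorem abs_family_sub_le (hQ : IsPeriodicLipschitz Q M L) {ε c : ℝ}
    {R : C(AddCircle (2 * Real.pi), ℝ)}
    (hR : ∀ θ : ℝ, R θ = c + ε * oscPrimitive (fun s => Q s (R s)) θ) (θ : ℝ) :
    |R θ - c| ≤ 4 * Real.pi * M * |ε| := by
  rw [hR, add_sub_cancel_left, abs_mul, mul_comm]
  exact mul_le_mul_of_nonneg_right (abs_oscPrimitive_le (hQ.measurable_comp R)
    (fun _ => hQ.bound _ _) (hQ.periodic_comp R) θ) (abs_nonneg _)

/-- `R - S - (c - d)` is `ε` times a difference of oscillating primitives, hence at most `4π|ε|L‖R -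
S‖ ≤ ‖R - S‖ / 2`. Absorbing this gives the factor `2`, and substituting back turns `4π` into `8π`.
-/
theorem abs_family_sub_family_le (hQ : IsPeriodicLipschitz Q M L) {ε c d : ℝ}
    (hε : 8 * Real.pi * |ε| * L ≤ 1) {R S : C(AddCircle (2 * Real.pi), ℝ)}
    (hR : ∀ θ : ℝ, R θ = c + ε * oscPrimitive (fun s => Q s (R s)) θ)
    (hS : ∀ θ : ℝ, S θ = d + ε * oscPrimitive (fun s => Q s (S s)) θ) :
    (∀ θ : ℝ, |R θ - S θ| ≤ 2 * |c - d|) ∧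
      ∀ θ : ℝ, |R θ - S θ - (c - d)| ≤ 8 * Real.pi * |ε| * L * |c - d| := by
  have h1 : ∀ θ : ℝ, |R θ - S θ - (c - d)| ≤ 4 * Real.pi * |ε| * L * ‖R - S‖ := by
    intro θ
    have : R θ - S θ - (c - d) = ε * (oscPrimitive (fun s => Q s (R s)) θ -
        oscPrimitive (fun s => Q s (S s)) θ) := by rw [hR θ, hS θ]; ring
    rw [this, abs_mul]
    calc _ ≤ |ε| * (4 * Real.pi * (L * ‖R - S‖)) :=
          mul_le_mul_of_nonneg_left (hQ.abs_oscPrimitive_sub_le R S θ) (abs_nonneg _)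
      _ = _ := by ring
  have h2 : ‖R - S‖ ≤ |c - d| + 4 * Real.pi * |ε| * L * ‖R - S‖ := by
    have := hQ.lipschitz_nonneg
    rw [ContinuousMap.norm_le _ (by positivity)]
    intro x
    induction x using QuotientAddGroup.induction_on with
    | H θ =>
      change |R θ - S θ| ≤ _
      have h3 := abs_add_le (R θ - S θ - (c - d)) (c - d)
      rw [sub_add_cancel] at h3
      linarith [h1 θ]
  have h3 : ‖R - S‖ ≤ 2 * |c - d| := by
    nlinarith [mul_le_mul_of_nonneg_right hε (norm_nonneg (R - S))]
  refine ⟨fun θ => ((R - S).norm_coe_le_norm θ).trans h3, fun θ => (h1 θ).trans ?_⟩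
  calc _ ≤ 4 * Real.pi * |ε| * L * (2 * |c - d|) := by
        have := hQ.lipschitz_nonneg
        gcongr
    _ = _ := by ring

end IsPeriodicLipschitz

end Lienard
end

/-! ### The polar equation and its uniform estimates. -/

noncomputable section

namespace Lienard

/-- The dissipative term at the point with polar radius `r`, where `p = (cos θ, sin θ, sgn sin θ)`. -/
def polarForce (f g : ℝ[X]) (p : ℝ × ℝ × ℝ) (r : ℝ) : ℝ :=
  f.eval (r * p.1) * (r * p.2.1) + p.2.2 * g.eval (r * p.1)

/-- The radial derivative of `polarForce`. -/
def polarForceDeriv (f g : ℝ[X]) (p : ℝ × ℝ × ℝ) (r : ℝ) : ℝ :=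
  f.derivative.eval (r * p.1) * p.1 * (r * p.2.1) + f.eval (r * p.1) * p.2.1 +
    p.2.2 * (g.derivative.eval (r * p.1) * p.1)

/-- The right-hand side of the polar equation `dr/dθ = ε * polarSlope`. -/
def polarSlope (f g : ℝ[X]) (p : ℝ × ℝ × ℝ) (r ε : ℝ) : ℝ :=
  p.2.1 * (r * polarForce f g p r / (r + ε * p.1 * polarForce f g p r))

/-- The radial derivative of `polarSlope`. -/
def polarSlopeDeriv (f g : ℝ[X]) (p : ℝ × ℝ × ℝ) (r ε : ℝ) : ℝ :=
  p.2.1 * (((polarForce f g p r + r * polarForceDeriv f g p r) *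
    (r + ε * p.1 * polarForce f g p r) -
      r * polarForce f g p r * (1 + ε * p.1 * polarForceDeriv f g p r)) /
        (r + ε * p.1 * polarForce f g p r) ^ 2)

/-- The trigonometric data of an angle entering the polar equation. -/
def trigData (θ : ℝ) : ℝ × ℝ × ℝ := (Real.cos θ, Real.sin θ, Real.sign (Real.sin θ))

/-- A compact set containing all values of `trigData`. -/
def trigBox : Set (ℝ × ℝ × ℝ) := Set.Icc (-1) 1 ×ˢ Set.Icc (-1) 1 ×ˢ Set.Icc (-1) 1

theorem isCompact_trigBox : IsCompact trigBox := isCompact_Icc.prod (isCompact_Icc.prod isCompact_Icc)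

theorem trigData_mem_trigBox (θ : ℝ) : trigData θ ∈ trigBox := by
  refine ⟨Real.cos_mem_Icc θ, Real.sin_mem_Icc θ, ?_⟩
  change Real.sign (Real.sin θ) ∈ _
  rcases Real.sign_apply_eq (Real.sin θ) with h | h | h <;> rw [h] <;> norm_num

theorem trigData_add_two_pi (θ : ℝ) : trigData (θ + 2 * Real.pi) = trigData θ := by
  simp [trigData]

theorem measurable_real_sign : Measurable Real.sign := by
  unfold Real.sign
  exact Measurable.ite measurableSet_Iio measurable_const
    (Measurable.ite measurableSet_Ioi measurable_const measurable_const)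

theorem measurable_trigData : Measurable trigData :=
  Real.measurable_cos.prodMk
    (Real.measurable_sin.prodMk (measurable_real_sign.comp Real.measurable_sin))

theorem continuousAt_trigData {θ : ℝ} (h : Real.sin θ ≠ 0) : ContinuousAt trigData θ := by
  have hs : ContinuousAt (fun x => Real.sign (Real.sin x)) θ := by
    rcases lt_or_gt_of_ne h with h | h
    · refine (continuousAt_const (y := (-1 : ℝ))).congr ?_
      filter_upwards [Real.continuous_sin.continuousAt.eventually_lt continuousAt_const h]
        with x hx using (Real.sign_of_neg hx).symm
    · refine (continuousAt_const (y := (1 : ℝ))).congr ?_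
      filter_upwards [continuousAt_const.eventually_lt Real.continuous_sin.continuousAt h]
        with x hx using (Real.sign_of_pos hx).symm
  exact Real.continuous_cos.continuousAt.prodMk (Real.continuous_sin.continuousAt.prodMk hs)

variable (f g : ℝ[X])

theorem continuous_polarForce :
    Continuous fun q : (ℝ × ℝ × ℝ) × ℝ => polarForce f g q.1 q.2 := by
  unfold polarForce; fun_prop

theorem continuous_polarForceDeriv :
    Continuous fun q : (ℝ × ℝ × ℝ) × ℝ => polarForceDeriv f g q.1 q.2 := by
  unfold polarForceDeriv; fun_prop

theorem measurable_polarSlope (ε : ℝ) :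
    Measurable fun q : (ℝ × ℝ × ℝ) × ℝ => polarSlope f g q.1 q.2 ε := by
  have := (continuous_polarForce f g).measurable
  unfold polarSlope
  fun_prop

theorem hasDerivAt_polarForce (p : ℝ × ℝ × ℝ) (r : ℝ) :
    HasDerivAt (polarForce f g p) (polarForceDeriv f g p r) r := by
  have h : HasDerivAt (fun x : ℝ => x * p.1) p.1 r := by
    simpa using (hasDerivAt_id r).mul_const p.1
  have h' : HasDerivAt (fun x : ℝ => x * p.2.1) p.2.1 r := by
    simpa using (hasDerivAt_id r).mul_const p.2.1
  exact ((((f.hasDerivAt _).comp r h).mul h').add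
    (((g.hasDerivAt _).comp r h).const_mul p.2.2)).congr_deriv (by simp [polarForceDeriv])

theorem hasDerivAt_polarSlope (p : ℝ × ℝ × ℝ) (r ε : ℝ)
    (h : r + ε * p.1 * polarForce f g p r ≠ 0) :
    HasDerivAt (fun x => polarSlope f g p x ε) (polarSlopeDeriv f g p r ε) r := by
  have hk := hasDerivAt_polarForce f g p r
  have := (((hasDerivAt_id r).mul hk).div ((hasDerivAt_id r).add (hk.const_mul (ε * p.1)))
    h).const_mul p.2.1
  exact this.congr_deriv (by simp [polarSlopeDeriv])

theorem continuousAt_polarSlope {q : (ℝ × ℝ) × ℝ × ℝ × ℝ}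
    (h : q.1.1 + q.1.2 * q.2.1 * polarForce f g q.2 q.1.1 ≠ 0) :
    ContinuousAt (fun q : (ℝ × ℝ) × ℝ × ℝ × ℝ => polarSlope f g q.2 q.1.1 q.1.2) q := by
  have hk : Continuous fun q : (ℝ × ℝ) × ℝ × ℝ × ℝ => polarForce f g q.2 q.1.1 :=
    (continuous_polarForce f g).comp (by fun_prop : Continuous
      fun q : (ℝ × ℝ) × ℝ × ℝ × ℝ => (q.2, q.1.1))
  refine ContinuousAt.mul (by fun_prop) (ContinuousAt.div ?_ ?_ h)
  · exact (continuous_fst.fst.mul hk).continuousAt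
  · exact (continuous_fst.fst.add
      ((continuous_fst.snd.mul continuous_snd.fst).mul hk)).continuousAt

theorem continuousAt_polarSlopeDeriv {q : (ℝ × ℝ) × ℝ × ℝ × ℝ}
    (h : q.1.1 + q.1.2 * q.2.1 * polarForce f g q.2 q.1.1 ≠ 0) :
    ContinuousAt (fun q : (ℝ × ℝ) × ℝ × ℝ × ℝ => polarSlopeDeriv f g q.2 q.1.1 q.1.2) q := by
  have hk : Continuous fun q : (ℝ × ℝ) × ℝ × ℝ × ℝ => polarForce f g q.2 q.1.1 :=
    (continuous_polarForce f g).comp (by fun_prop : Continuous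
      fun q : (ℝ × ℝ) × ℝ × ℝ × ℝ => (q.2, q.1.1))
  have hk' : Continuous fun q : (ℝ × ℝ) × ℝ × ℝ × ℝ => polarForceDeriv f g q.2 q.1.1 :=
    (continuous_polarForceDeriv f g).comp (by fun_prop : Continuous
      fun q : (ℝ × ℝ) × ℝ × ℝ × ℝ => (q.2, q.1.1))
  refine ContinuousAt.mul (by fun_prop) (ContinuousAt.div ?_ ?_ (pow_ne_zero 2 h))
  · fun_prop
  · fun_prop

theorem averagedFunction_eq_circleMean {r : ℝ} (hr : 0 < r) :
    averagedFunction f g r = circleMean fun θ => polarSlope f g (trigData θ) r 0 := by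
  rw [averagedFunction, circleMean]
  congr 2
  ext θ
  have hs : Real.sign (r * Real.sin θ) = Real.sign (Real.sin θ) := by
    rcases lt_trichotomy (Real.sin θ) 0 with h | h | h
    · rw [Real.sign_of_neg (mul_neg_of_pos_of_neg hr h), Real.sign_of_neg h]
    · simp [h]
    · rw [Real.sign_of_pos (mul_pos hr h), Real.sign_of_pos h]
  simp only [polarSlope, polarForce, trigData, hs, zero_mul, add_zero]
  rw [mul_div_cancel_left₀ _ hr.ne']

/-- On the window of radius `δ` about `r₀` and for `|ε| ≤ δ`, the angular speed stays away from `0`,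
and the polar equation and its radial derivative are `κ`-close to their values at `(r₀, 0)`. -/
structure IsWindow (r₀ δ κ : ℝ) : Prop where
  pos : 0 < δ
  lt : δ < r₀
  speed : ∀ r ε, |r - r₀| ≤ δ → |ε| ≤ δ → ∀ p ∈ trigBox, |ε * polarForce f g p r| ≤ r / 2
  slope : ∀ r ε, |r - r₀| ≤ δ → |ε| ≤ δ → ∀ p ∈ trigBox,
    |polarSlope f g p r ε - polarSlope f g p r₀ 0| ≤ κ
  slopeDeriv : ∀ r ε, |r - r₀| ≤ δ → |ε| ≤ δ → ∀ p ∈ trigBox,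
    |polarSlopeDeriv f g p r ε - polarSlopeDeriv f g p r₀ 0| ≤ κ

/-- The angle enters only through a point of the compact `trigBox`, with the sign as an independent
coordinate. There the functions are jointly continuous near `(r₀, 0)` despite the jump in `θ`, and
compactness makes the estimates uniform. -/
theorem exists_isWindow {r₀ κ : ℝ} (hr₀ : 0 < r₀) (hκ : 0 < κ) :
    ∃ δ₀ > 0, ∀ δ, 0 < δ → δ < δ₀ → IsWindow f g r₀ δ κ := by
  have hk : Continuous fun q : (ℝ × ℝ) × ℝ × ℝ × ℝ => polarForce f g q.2 q.1.1 :=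
    (continuous_polarForce f g).comp (by fun_prop : Continuous
      fun q : (ℝ × ℝ) × ℝ × ℝ × ℝ => (q.2, q.1.1))
  have hden : ∀ p : ℝ × ℝ × ℝ, r₀ + 0 * p.1 * polarForce f g p r₀ ≠ 0 := by
    intro p; simpa using hr₀.ne'
  have hbase : ∀ p : ℝ × ℝ × ℝ, ContinuousAt (fun q : (ℝ × ℝ) × ℝ × ℝ × ℝ =>
      (((r₀, 0), q.2) : (ℝ × ℝ) × ℝ × ℝ × ℝ)) ((r₀, 0), p) := fun p => by fun_prop
  have h1 : ∀ᶠ x : ℝ × ℝ in 𝓝 (r₀, 0), ∀ p ∈ trigBox,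
      |x.2 * polarForce f g p x.1| - x.1 / 2 < 0 := by
    refine isCompact_trigBox.eventually_forall_of_forall_eventually fun p _ => ?_
    have hc : Continuous fun q : (ℝ × ℝ) × ℝ × ℝ × ℝ =>
        |q.1.2 * polarForce f g q.2 q.1.1| - q.1.1 / 2 := by fun_prop
    exact hc.continuousAt.eventually_lt_const (by simpa using hr₀)
  have h2 : ∀ᶠ x : ℝ × ℝ in 𝓝 (r₀, 0), ∀ p ∈ trigBox,
      |polarSlope f g p x.1 x.2 - polarSlope f g p r₀ 0| < κ := by
    refine isCompact_trigBox.eventually_forall_of_forall_eventually fun p _ => ?_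
    have hc := (continuousAt_polarSlope f g (q := ((r₀, 0), p)) (hden p))
    exact (hc.sub (ContinuousAt.comp (f := fun q : (ℝ × ℝ) × ℝ × ℝ × ℝ =>
      (((r₀, 0), q.2) : (ℝ × ℝ) × ℝ × ℝ × ℝ)) hc (hbase p))).abs.eventually_lt_const
        (by simpa using hκ)
  have h3 : ∀ᶠ x : ℝ × ℝ in 𝓝 (r₀, 0), ∀ p ∈ trigBox,
      |polarSlopeDeriv f g p x.1 x.2 - polarSlopeDeriv f g p r₀ 0| < κ := by
    refine isCompact_trigBox.eventually_forall_of_forall_eventually fun p _ => ?_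
    have hc := (continuousAt_polarSlopeDeriv f g (q := ((r₀, 0), p)) (hden p))
    exact (hc.sub (ContinuousAt.comp (f := fun q : (ℝ × ℝ) × ℝ × ℝ × ℝ =>
      (((r₀, 0), q.2) : (ℝ × ℝ) × ℝ × ℝ × ℝ)) hc (hbase p))).abs.eventually_lt_const
        (by simpa using hκ)
  obtain ⟨δ₀, hδ₀, h⟩ := Metric.eventually_nhds_iff.1 (h1.and (h2.and h3))
  have h' : ∀ δ, δ < min δ₀ r₀ → ∀ r ε, |r - r₀| ≤ δ → |ε| ≤ δ → dist (r, ε) (r₀, 0) < δ₀ := by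
    intro δ hδ r ε hr hε
    rw [Prod.dist_eq, Real.dist_eq, Real.dist_eq, sub_zero]
    exact (max_le hr hε).trans_lt (hδ.trans_le (min_le_left _ _))
  refine ⟨min δ₀ r₀, lt_min hδ₀ hr₀, fun δ hδ hlt => ⟨hδ, hlt.trans_le (min_le_right _ _), ?_, ?_, ?_⟩⟩
  · exact fun r ε hr hε p hp => (sub_neg.1 ((h (h' δ hlt r ε hr hε)).1 p hp)).le
  · exact fun r ε hr hε p hp => ((h (h' δ hlt r ε hr hε)).2.1 p hp).le
  · exact fun r ε hr hε p hp => ((h (h' δ hlt r ε hr hε)).2.2 p hp).le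

theorem exists_bound_at (r₀ : ℝ) (hr₀ : 0 < r₀) : ∃ B > 0, ∀ p ∈ trigBox,
    |polarSlope f g p r₀ 0| ≤ B ∧ |polarSlopeDeriv f g p r₀ 0| ≤ B := by
  have hden : ∀ p : ℝ × ℝ × ℝ, r₀ + 0 * p.1 * polarForce f g p r₀ ≠ 0 := by
    intro p; simpa using hr₀.ne'
  have hbase : Continuous fun p : ℝ × ℝ × ℝ => (((r₀, 0), p) : (ℝ × ℝ) × ℝ × ℝ × ℝ) := by fun_prop
  have h1 : Continuous fun p => polarSlope f g p r₀ 0 := continuous_iff_continuousAt.2 fun p =>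
    ContinuousAt.comp (f := fun p : ℝ × ℝ × ℝ => (((r₀, 0), p) : (ℝ × ℝ) × ℝ × ℝ × ℝ))
      (continuousAt_polarSlope f g (hden p)) hbase.continuousAt
  have h2 : Continuous fun p => polarSlopeDeriv f g p r₀ 0 := continuous_iff_continuousAt.2 fun p =>
    ContinuousAt.comp (f := fun p : ℝ × ℝ × ℝ => (((r₀, 0), p) : (ℝ × ℝ) × ℝ × ℝ × ℝ))
      (continuousAt_polarSlopeDeriv f g (hden p)) hbase.continuousAt
  obtain ⟨B₁, hB₁⟩ := isCompact_trigBox.exists_bound_of_continuousOn h1.continuousOn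
  obtain ⟨B₂, hB₂⟩ := isCompact_trigBox.exists_bound_of_continuousOn h2.continuousOn
  refine ⟨max 1 (max B₁ B₂), by positivity, fun p hp => ⟨?_, ?_⟩⟩
  · exact (hB₁ p hp).trans ((le_max_left _ _).trans (le_max_right _ _))
  · exact (hB₂ p hp).trans ((le_max_right _ _).trans (le_max_right _ _))

/-- The nearest point of the interval `[r₀ - δ, r₀ + δ]`. -/
def clamp (r₀ δ r : ℝ) : ℝ := max (r₀ - δ) (min (r₀ + δ) r)

theorem abs_clamp_sub_le {r₀ δ : ℝ} (hδ : 0 < δ) (r : ℝ) : |clamp r₀ δ r - r₀| ≤ δ := by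
  rw [clamp, abs_le]
  constructor
  · linarith [le_max_left (r₀ - δ) (min (r₀ + δ) r)]
  · have : max (r₀ - δ) (min (r₀ + δ) r) ≤ r₀ + δ := max_le (by linarith) (min_le_left _ _)
    linarith

theorem clamp_of_abs_le {r₀ δ r : ℝ} (h : |r - r₀| ≤ δ) : clamp r₀ δ r = r := by
  rw [abs_le] at h
  rw [clamp, min_eq_right (by linarith), max_eq_right (by linarith)]

theorem abs_clamp_sub_clamp_le (r₀ δ u v : ℝ) : |clamp r₀ δ u - clamp r₀ δ v| ≤ |u - v| := by
  refine (abs_max_sub_max_le_max _ _ _ _).trans ?_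
  rw [sub_self, abs_zero]
  refine max_le (abs_nonneg _) ((abs_min_sub_min_le_max _ _ _ _).trans ?_)
  rw [sub_self, abs_zero]
  exact max_le (abs_nonneg _) le_rfl

variable {f g} {r₀ δ κ : ℝ}

namespace IsWindow

theorem radius_pos (hw : IsWindow f g r₀ δ κ) {r : ℝ} (hr : |r - r₀| ≤ δ) : 0 < r := by
  have := hw.lt
  rw [abs_le] at hr
  linarith

theorem denom_pos (hw : IsWindow f g r₀ δ κ) {r ε : ℝ} (hr : |r - r₀| ≤ δ) (hε : |ε| ≤ δ)
    {p : ℝ × ℝ × ℝ} (hp : p ∈ trigBox) : 0 < r + ε * p.1 * polarForce f g p r := by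
  have h1 := hw.speed r ε hr hε p hp
  have h2 : |p.1| ≤ 1 := abs_le.2 hp.1
  have h3 : |ε * p.1 * polarForce f g p r| ≤ r / 2 := by
    rw [mul_right_comm, abs_mul]
    exact (mul_le_of_le_one_right (abs_nonneg _) h2).trans h1
  linarith [neg_le_of_abs_le h3, hw.radius_pos hr]

/-- Mean value inequality for the slope minus its linear part with coefficient frozen at `(r₀, 0)`:
the derivative of this difference is at most `κ` on the window. -/
theorem abs_slope_sub_sub_le (hw : IsWindow f g r₀ δ κ) {u v ε : ℝ} (hu : |u - r₀| ≤ δ)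
    (hv : |v - r₀| ≤ δ) (hε : |ε| ≤ δ) {p : ℝ × ℝ × ℝ} (hp : p ∈ trigBox) :
    |polarSlope f g p u ε - polarSlope f g p v ε - polarSlopeDeriv f g p r₀ 0 * (u - v)| ≤
      κ * |u - v| := by
  have hconv : Convex ℝ {r : ℝ | |r - r₀| ≤ δ} := by
    have := convex_closedBall r₀ δ
    simpa [Metric.closedBall, Real.dist_eq] using this
  have := hconv.norm_image_sub_le_of_norm_hasDerivWithin_le
    (f := fun r => polarSlope f g p r ε - polarSlopeDeriv f g p r₀ 0 * r)
    (f' := fun r => polarSlopeDeriv f g p r ε - polarSlopeDeriv f g p r₀ 0) (C := κ)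
    (fun r hr => ((hasDerivAt_polarSlope f g p r ε (hw.denom_pos hr hε hp).ne').sub
      (((hasDerivAt_id r).const_mul _).congr_deriv (mul_one _))).hasDerivWithinAt)
    (fun r hr => hw.slopeDeriv r ε hr hε p hp) hv hu
  rw [Real.norm_eq_abs, Real.norm_eq_abs] at this
  convert this using 2
  ring

theorem κ_nonneg (hw : IsWindow f g r₀ δ κ) : 0 ≤ κ :=
  (abs_nonneg _).trans (hw.slope r₀ 0 (by simpa using hw.pos.le) (by simpa using hw.pos.le)
    _ (trigData_mem_trigBox 0))

/-- The right-hand side of the polar equation, made globally Lipschitz by clamping the radius. -/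
theorem isPeriodicLipschitz (hw : IsWindow f g r₀ δ κ) {ε : ℝ} (hε : |ε| ≤ δ) {B : ℝ}
    (hB : ∀ p ∈ trigBox, |polarSlope f g p r₀ 0| ≤ B ∧ |polarSlopeDeriv f g p r₀ 0| ≤ B) :
    IsPeriodicLipschitz (fun θ r => polarSlope f g (trigData θ) (clamp r₀ δ r) ε)
      (B + κ) (B + κ) where
  periodic θ r := by simp only [trigData_add_two_pi]
  measurable R hR := by
    have h : Measurable fun θ => clamp r₀ δ (R θ) := by
      unfold clamp
      exact (continuous_const.max (continuous_const.min hR)).measurable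
    exact (measurable_polarSlope f g ε).comp (measurable_trigData.prodMk h)
  bound θ r := by
    have h1 := hw.slope _ ε (abs_clamp_sub_le hw.pos r) hε _ (trigData_mem_trigBox θ)
    have h2 := (hB _ (trigData_mem_trigBox θ)).1
    have h3 := abs_add_le (polarSlope f g (trigData θ) (clamp r₀ δ r) ε -
      polarSlope f g (trigData θ) r₀ 0) (polarSlope f g (trigData θ) r₀ 0)
    rw [sub_add_cancel] at h3
    linarith
  lipschitz θ u v := by
    have h1 := hw.abs_slope_sub_sub_le (abs_clamp_sub_le hw.pos u) (abs_clamp_sub_le hw.pos v) hε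
      (trigData_mem_trigBox θ)
    have h2 := (hB _ (trigData_mem_trigBox θ)).2
    have h3 := abs_clamp_sub_clamp_le r₀ δ u v
    have h4 := abs_add_le (polarSlope f g (trigData θ) (clamp r₀ δ u) ε -
      polarSlope f g (trigData θ) (clamp r₀ δ v) ε - polarSlopeDeriv f g (trigData θ) r₀ 0 *
        (clamp r₀ δ u - clamp r₀ δ v)) (polarSlopeDeriv f g (trigData θ) r₀ 0 *
        (clamp r₀ δ u - clamp r₀ δ v))
    rw [sub_add_cancel, abs_mul] at h4
    have h5 := mul_le_mul_of_nonneg_right h2 (abs_nonneg (clamp r₀ δ u - clamp r₀ δ v))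
    have h6 : 0 ≤ B + κ := by
      linarith [hw.κ_nonneg, (abs_nonneg _).trans h2]
    calc _ ≤ (B + κ) * |clamp r₀ δ u - clamp r₀ δ v| := by linarith
      _ ≤ _ := mul_le_mul_of_nonneg_left h3 h6

end IsWindow

theorem circleMean_mul_const (q : ℝ → ℝ) (c : ℝ) :
    circleMean (fun s => q s * c) = circleMean q * c := by
  rw [circleMean, intervalIntegral.integral_mul_const, circleMean]; ring

theorem measurable_polarSlopeDeriv_trigData (r : ℝ) :
    Measurable fun θ => polarSlopeDeriv f g (trigData θ) r 0 := by
  have h1 : Measurable fun θ => polarForce f g (trigData θ) r :=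
    (continuous_polarForce f g).measurable.comp (measurable_trigData.prodMk measurable_const)
  have h2 : Measurable fun θ => polarForceDeriv f g (trigData θ) r :=
    (continuous_polarForceDeriv f g).measurable.comp (measurable_trigData.prodMk measurable_const)
  have h3 := measurable_trigData
  unfold polarSlopeDeriv
  fun_prop

/-- For each tolerance `κ` the window estimate bounds the linearization error of the integrand by `κ
|u - r₀|` uniformly in the angle, and averaging preserves the bound. -/
theorem hasDerivAt_averagedFunction (hr₀ : 0 < r₀) :
    HasDerivAt (averagedFunction f g)
      (circleMean fun θ => polarSlopeDeriv f g (trigData θ) r₀ 0) r₀ := by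
  rw [hasDerivAt_iff_isLittleO, Asymptotics.isLittleO_iff]
  intro κ hκ
  obtain ⟨δ₀, hδ₀, hδ⟩ := exists_isWindow f g hr₀ hκ
  obtain ⟨B, -, hB⟩ := exists_bound_at f g r₀ hr₀
  have hw := hδ (δ₀ / 2) (by positivity) (by linarith)
  filter_upwards [Metric.closedBall_mem_nhds r₀ hw.pos] with u hu
  rw [Metric.mem_closedBall, Real.dist_eq] at hu
  have h0 : |r₀ - r₀| ≤ δ₀ / 2 := by simpa using hw.pos.le
  have he : |(0 : ℝ)| ≤ δ₀ / 2 := by simpa using hw.pos.le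
  have hI : ∀ r, |r - r₀| ≤ δ₀ / 2 → ∀ a b, IntervalIntegrable
      (fun θ => polarSlope f g (trigData θ) r 0) MeasureTheory.volume a b := by
    intro r hr
    refine intervalIntegrable_of_abs_le (M := B + κ)
      ((measurable_polarSlope f g 0).comp (measurable_trigData.prodMk measurable_const))
      fun θ => ?_
    have := (hw.isPeriodicLipschitz he hB).bound θ r
    simpa only [clamp_of_abs_le hr] using this
  have hI' : ∀ a b, IntervalIntegrable (fun θ => polarSlopeDeriv f g (trigData θ) r₀ 0 * (u - r₀))
      MeasureTheory.volume a b := fun a b =>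
    (intervalIntegrable_of_abs_le (measurable_polarSlopeDeriv_trigData r₀)
      (fun θ => (hB _ (trigData_mem_trigBox θ)).2) a b).mul_const _
  rw [averagedFunction_eq_circleMean f g (hw.radius_pos hu),
    averagedFunction_eq_circleMean f g hr₀, smul_eq_mul, mul_comm (u - r₀), ← circleMean_mul_const,
    ← circleMean_sub (hI u hu) (hI r₀ h0),
    ← circleMean_sub (fun a b => (hI u hu a b).sub (hI r₀ h0 a b)) hI']
  exact abs_circleMean_le fun θ => hw.abs_slope_sub_sub_le hu h0 he (trigData_mem_trigBox θ)

end Lienard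
end

/-! ### Trajectories in polar coordinates: barriers and winding. -/

noncomputable section

namespace Lienard

/-- A point of the plane as a complex number. -/
def toComplex (p : ℝ × ℝ) : ℂ := ⟨p.1, p.2⟩

theorem continuous_toComplex : Continuous toComplex :=
  Complex.equivRealProdCLM.symm.continuous

theorem norm_toComplex_sq (p : ℝ × ℝ) : ‖toComplex p‖ ^ 2 = p.1 ^ 2 + p.2 ^ 2 := by
  rw [Complex.sq_norm, Complex.normSq_apply, toComplex]; ring

theorem fst_eq_polar (p : ℝ × ℝ) :
    p.1 = ‖toComplex p‖ * Real.cos (toComplex p).arg :=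
  (Complex.norm_mul_cos_arg (toComplex p)).symm

theorem snd_eq_polar (p : ℝ × ℝ) :
    p.2 = ‖toComplex p‖ * Real.sin (toComplex p).arg :=
  (Complex.norm_mul_sin_arg (toComplex p)).symm

theorem sign_mul_of_pos {r : ℝ} (hr : 0 < r) (x : ℝ) : Real.sign (r * x) = Real.sign x := by
  rcases lt_trichotomy x 0 with h | h | h
  · rw [Real.sign_of_neg (mul_neg_of_pos_of_neg hr h), Real.sign_of_neg h]
  · simp [h]
  · rw [Real.sign_of_pos (mul_pos hr h), Real.sign_of_pos h]

theorem field_polar (f g : ℝ[X]) (ε : ℝ) {r : ℝ} (hr : 0 < r) (θ : ℝ) :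
    field f g ε (r * Real.cos θ, r * Real.sin θ) =
      (r * Real.sin θ, -(r * Real.cos θ) - ε * polarForce f g (trigData θ) r) := by
  simp only [field, polarForce, trigData, sign_mul_of_pos hr]

/-- The angular speed of the system, clockwise. -/
def angularSpeed (f g : ℝ[X]) (p : ℝ × ℝ × ℝ) (r ε : ℝ) : ℝ :=
  1 + ε * p.1 * polarForce f g p r / r

theorem angularSpeed_mem {f g : ℝ[X]} {p : ℝ × ℝ × ℝ} {r ε : ℝ} (hr : 0 < r) (hp : p ∈ trigBox)
    (h : |ε * polarForce f g p r| ≤ r / 2) :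
    1 / 2 ≤ angularSpeed f g p r ε ∧ angularSpeed f g p r ε ≤ 3 / 2 := by
  have h2 : |p.1| ≤ 1 := abs_le.2 hp.1
  have h3 : |ε * p.1 * polarForce f g p r / r| ≤ 1 / 2 := by
    rw [abs_div, abs_of_pos hr, div_le_iff₀ hr, mul_right_comm, abs_mul]
    exact (mul_le_of_le_one_right (abs_nonneg _) h2).trans (by linarith)
  rw [abs_le] at h3
  constructor <;> rw [angularSpeed] <;> linarith [h3.1, h3.2]

/-- Converts between derivatives in the angle and derivatives in time. -/
theorem polarSlope_mul_angularSpeed {f g : ℝ[X]} {p : ℝ × ℝ × ℝ} {r ε : ℝ} (hr : 0 < r)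
    (h : angularSpeed f g p r ε ≠ 0) :
    polarSlope f g p r ε * angularSpeed f g p r ε = p.2.1 * polarForce f g p r := by
  have h1 : r + ε * p.1 * polarForce f g p r = r * angularSpeed f g p r ε := by
    rw [angularSpeed]; field_simp
  rw [polarSlope, h1]
  field_simp

namespace IsTrajectory

variable {f g : ℝ[X]} {ε : ℝ} {γ : ℝ → ℝ × ℝ}

/-- At the origin the two vertical components are `∓ε g(0)`, whose product is not positive, so the
origin is never a crossing point. Polar coordinates are thus available along every trajectory. -/
theorem toComplex_ne_zero (hγ : IsTrajectory f g ε γ) (t : ℝ) : toComplex (γ t) ≠ 0 := by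
  intro h
  have h1 : (γ t).1 = 0 := congrArg Complex.re h
  have h2 : (γ t).2 = 0 := congrArg Complex.im h
  have h3 := (hγ.crossing t h2).2
  simp only [upperField, lowerField, h1, h2] at h3
  nlinarith [sq_nonneg (ε * eval 0 g)]

theorem norm_pos (hγ : IsTrajectory f g ε γ) (t : ℝ) : 0 < ‖toComplex (γ t)‖ :=
  norm_pos_iff.2 (hγ.toComplex_ne_zero t)

theorem eventually_snd_ne_zero (hγ : IsTrajectory f g ε γ) (t : ℝ) :
    ∀ᶠ s in 𝓝[≠] t, (γ s).2 ≠ 0 := by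
  by_cases h : (γ t).2 = 0
  · exact hγ.isolated t h
  · exact (hγ.continuous.snd.continuousAt.eventually_ne h).filter_mono nhdsWithin_le_nhds

theorem sin_arg_ne_zero {p : ℝ × ℝ} (h : p.2 ≠ 0) : Real.sin (toComplex p).arg ≠ 0 := by
  intro h0
  rw [snd_eq_polar, h0, mul_zero] at h
  exact h rfl

/-- The logarithmic derivative `z'/z` carries the radial rate and the angular speed together. The
factor `c` does not change it but allows the branch cut to be moved. -/
theorem hasDerivAt_log (hγ : IsTrajectory f g ε γ) {t : ℝ} (ht : (γ t).2 ≠ 0) {c : ℂ}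
    (hc : c * toComplex (γ t) ∈ Complex.slitPlane) :
    HasDerivAt (fun s => Complex.log (c * toComplex (γ s)))
      ⟨-ε * Real.sin (toComplex (γ t)).arg *
          polarForce f g (trigData (toComplex (γ t)).arg) ‖toComplex (γ t)‖ / ‖toComplex (γ t)‖,
        -angularSpeed f g (trigData (toComplex (γ t)).arg) ‖toComplex (γ t)‖ ε⟩ t := by
  have h1 := hγ.hasDerivAt t ht
  have h2 : HasDerivAt (fun s => toComplex (γ s)) (toComplex (field f g ε (γ t))) t :=
    (Complex.equivRealProdCLM.symm.hasFDerivAt (x := γ t)).comp_hasDerivAt t h1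
  have h3 := (h2.const_mul c).clog_real hc
  have hc0 : c ≠ 0 := by
    rintro rfl
    simp at hc
  refine h3.congr_deriv ?_
  rw [mul_div_mul_left _ _ hc0, div_eq_iff (hγ.toComplex_ne_zero t)]
  have hpolar : γ t = (‖toComplex (γ t)‖ * Real.cos (toComplex (γ t)).arg,
      ‖toComplex (γ t)‖ * Real.sin (toComplex (γ t)).arg) :=
    Prod.ext (fst_eq_polar _) (snd_eq_polar _)
  have hr := hγ.norm_pos t
  have hz : toComplex (γ t) = ⟨‖toComplex (γ t)‖ * Real.cos (toComplex (γ t)).arg,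
      ‖toComplex (γ t)‖ * Real.sin (toComplex (γ t)).arg⟩ :=
    Complex.ext (fst_eq_polar _) (snd_eq_polar _)
  have hF : field f g ε (γ t) = _ := (congrArg (field f g ε) hpolar).trans
    (field_polar f g ε hr (toComplex (γ t)).arg)
  rw [hF]
  generalize ‖toComplex (γ t)‖ = r at *
  generalize (toComplex (γ t)).arg = α at *
  rw [hz]
  have hsc := Real.sin_sq_add_cos_sq α
  apply Complex.ext
  · simp only [toComplex, Complex.mul_re, angularSpeed, trigData]
    field_simp
    ring
  · simp only [toComplex, Complex.mul_im, angularSpeed]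
    simp only [show (trigData α).1 = Real.cos α from rfl]
    field_simp
    linear_combination (ε * polarForce f g (trigData α) r) * hsc

theorem hasDerivAt_arg (hγ : IsTrajectory f g ε γ) {t : ℝ} (ht : (γ t).2 ≠ 0) {c : ℂ}
    (hc : c * toComplex (γ t) ∈ Complex.slitPlane) :
    HasDerivAt (fun s => (c * toComplex (γ s)).arg)
      (-angularSpeed f g (trigData (toComplex (γ t)).arg) ‖toComplex (γ t)‖ ε) t := by
  have := (Complex.imCLM.hasFDerivAt).comp_hasDerivAt t (hγ.hasDerivAt_log ht hc)
  refine this.congr_of_eventuallyEq (Eventually.of_forall fun s => ?_)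
  simp [Complex.log_im]

theorem mem_slitPlane {p : ℝ × ℝ} (h : p.2 ≠ 0) : toComplex p ∈ Complex.slitPlane :=
  Complex.mem_slitPlane_iff.2 (Or.inr h)

theorem hasDerivAt_norm (hγ : IsTrajectory f g ε γ) {t : ℝ} (ht : (γ t).2 ≠ 0) :
    HasDerivAt (fun s => ‖toComplex (γ s)‖)
      (-ε * Real.sin (toComplex (γ t)).arg *
          polarForce f g (trigData (toComplex (γ t)).arg) ‖toComplex (γ t)‖) t := by
  have h1 := hγ.hasDerivAt_log ht (c := 1) (by simpa using mem_slitPlane ht)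
  have h2 := ((Complex.reCLM.hasFDerivAt).comp_hasDerivAt t h1).exp
  have hr := hγ.norm_pos t
  refine (h2.congr_of_eventuallyEq (Eventually.of_forall fun s => ?_)).congr_deriv ?_
  · simp [Complex.log_re, Real.exp_log (hγ.norm_pos s)]
  · simp only [Function.comp, Complex.reCLM_apply, one_mul, Complex.log_re, Real.exp_log hr]
    field_simp

end IsTrajectory

/-- The closed curve `r = R(θ)`. -/
def polarCurve (R : C(AddCircle (2 * Real.pi), ℝ)) : Set (ℝ × ℝ) :=
  Set.range fun θ : ℝ => (R θ * Real.cos θ, R θ * Real.sin θ)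

/-- The periodic function `R` solves `R' = ε (polarSlope - m)` away from the discontinuity line. -/
def IsPolarSolution (f g : ℝ[X]) (ε m : ℝ) (R : C(AddCircle (2 * Real.pi), ℝ)) : Prop :=
  ∀ θ : ℝ, Real.sin θ ≠ 0 → HasDerivAt (fun x : ℝ => R x)
    (ε * (polarSlope f g (trigData θ) (R θ) ε - m)) θ

/-- The signed radial distance of a point from the closed curve `r = R(θ)`. -/
def radialOffset (R : C(AddCircle (2 * Real.pi), ℝ)) (p : ℝ × ℝ) : ℝ :=
  ‖toComplex p‖ - R ((toComplex p).arg : ℝ)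

/-- The argument jumps on the negative axis, but its class modulo `2π` is continuous away from `0`,
and `R` lives on the circle. -/
theorem IsTrajectory.continuous_radialOffset {f g : ℝ[X]} {ε : ℝ} {γ : ℝ → ℝ × ℝ}
    (hγ : IsTrajectory f g ε γ) (R : C(AddCircle (2 * Real.pi), ℝ)) :
    Continuous fun t => radialOffset R (γ t) := by
  have hz : Continuous fun t => toComplex (γ t) := continuous_toComplex.comp hγ.continuous
  refine hz.norm.sub (continuous_iff_continuousAt.2 fun t => ?_)
  have h : ContinuousAt (fun s => (((toComplex (γ s)).arg : ℝ) : AddCircle (2 * Real.pi))) t :=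
    ContinuousAt.comp (f := fun s => toComplex (γ s)) (x := t)
      (Complex.continuousAt_arg_coe_angle (hγ.toComplex_ne_zero t)) hz.continuousAt
  exact R.continuous.continuousAt.comp h

theorem mem_polarCurve_of_radialOffset_eq_zero {R : C(AddCircle (2 * Real.pi), ℝ)} {p : ℝ × ℝ}
    (h : radialOffset R p = 0) : p ∈ polarCurve R :=
  ⟨(toComplex p).arg, by
    change (R ((toComplex p).arg : ℝ) * _, R ((toComplex p).arg : ℝ) * _) = p
    rw [← sub_eq_zero.1 h]
    exact (Prod.ext (fst_eq_polar p) (snd_eq_polar p)).symm⟩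

variable {f g : ℝ[X]} {r₀ δ κ ε : ℝ}

/-- On the curve itself the two slopes cancel and the derivative is `-ε ω m`, of constant sign: this
is the transversality used below. -/
theorem IsTrajectory.hasDerivAt_radialOffset (hw : IsWindow f g r₀ δ κ) (hε : |ε| ≤ δ)
    {γ : ℝ → ℝ × ℝ} (hγ : IsTrajectory f g ε γ) {m : ℝ} {R : C(AddCircle (2 * Real.pi), ℝ)}
    (hR : IsPolarSolution f g ε m R) {t : ℝ} (ht : (γ t).2 ≠ 0)
    (hδ : |‖toComplex (γ t)‖ - r₀| ≤ δ) :
    HasDerivAt (fun s => radialOffset R (γ s))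
      (-ε * angularSpeed f g (trigData (toComplex (γ t)).arg) ‖toComplex (γ t)‖ ε *
        (polarSlope f g (trigData (toComplex (γ t)).arg) ‖toComplex (γ t)‖ ε -
          polarSlope f g (trigData (toComplex (γ t)).arg) (R ((toComplex (γ t)).arg : ℝ)) ε + m))
      t := by
  have h1 := hγ.hasDerivAt_norm ht
  have h2 := hγ.hasDerivAt_arg ht (c := 1) (by simpa using mem_slitPlane ht)
  simp only [one_mul] at h2
  have h3 := (hR _ (sin_arg_ne_zero ht)).comp t h2
  have hr := hγ.norm_pos t
  have hp := trigData_mem_trigBox (toComplex (γ t)).arg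
  have hω := (angularSpeed_mem hr hp (hw.speed _ ε hδ hε _ hp)).1
  have h4 := polarSlope_mul_angularSpeed (f := f) (g := g) (ε := ε) hr
    (p := trigData (toComplex (γ t)).arg) (by linarith)
  have h5 : (trigData (toComplex (γ t)).arg).2.1 = Real.sin (toComplex (γ t)).arg := rfl
  rw [h5] at h4
  refine (h1.sub h3).congr_deriv ?_
  linear_combination ε * h4

/-- No periodic trajectory touches a closed curve that is transversal to the system. -/
theorem IsTrajectory.radialOffset_ne_zero (hw : IsWindow f g r₀ δ κ) (hε : |ε| ≤ δ) (hε0 : ε ≠ 0)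
    {B : ℝ} (hB : ∀ p ∈ trigBox, |polarSlope f g p r₀ 0| ≤ B ∧ |polarSlopeDeriv f g p r₀ 0| ≤ B)
    {γ : ℝ → ℝ × ℝ} (hγ : IsTrajectory f g ε γ) {T : ℝ} (hT : 0 < T)
    (hper : Function.Periodic γ T) {m : ℝ} (hm : m ≠ 0) {R : C(AddCircle (2 * Real.pi), ℝ)}
    (hR : IsPolarSolution f g ε m R) (hRδ : ∀ θ : ℝ, |R θ - r₀| < δ) (t : ℝ) :
    radialOffset R (γ t) ≠ 0 := by
  have hcont := hγ.continuous_radialOffset R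
  have hz : Continuous fun t => toComplex (γ t) := continuous_toComplex.comp hγ.continuous
  -- With this factor the derivative is `ε² ω m (Δ + m)`, where `Δ` is the difference of slopes. It
  -- is positive once `|Δ| < |m|`, which the Lipschitz bound ensures near the curve, so all zeros
  -- are upward crossings.
  have key : ∀ s, -(ε * m) * radialOffset R (γ s) ≠ 0 := by
    refine ne_zero_of_periodic_of_upcrossing (u := fun s => -(ε * m) * radialOffset R (γ s))
      (continuous_const.mul hcont) hT (fun s => by simp only [hper s]) fun s hs => ?_
    have hs0 : radialOffset R (γ s) = 0 := by
      simpa [hε0, hm] using hs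
    have hnear1 : ∀ᶠ x in 𝓝 s, |‖toComplex (γ x)‖ - r₀| < δ := by
      refine (hz.norm.sub continuous_const).abs.continuousAt.eventually_lt_const ?_
      change |‖toComplex (γ s)‖ - r₀| < δ
      rw [sub_eq_zero.1 hs0]
      exact hRδ _
    have hnear2 : ∀ᶠ x in 𝓝 s, (B + κ) * |radialOffset R (γ x)| < |m| := by
      refine (continuous_const.mul hcont.abs).continuousAt.eventually_lt_const ?_
      change (B + κ) * |radialOffset R (γ s)| < |m|
      rw [hs0, abs_zero, mul_zero]
      exact abs_pos.2 hm
    have := eventually_lt_of_deriv_pos (u := fun s => -(ε * m) * radialOffset R (γ s)) (t := s)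
      (continuous_const.mul hcont).continuousAt ?_
    · simpa only [hs] using this
    filter_upwards [hγ.eventually_snd_ne_zero s, nhdsWithin_le_nhds hnear1,
      nhdsWithin_le_nhds hnear2] with x hx0 hx1 hx2
    refine ⟨_, ?_, (hγ.hasDerivAt_radialOffset hw hε hR hx0 hx1.le).const_mul _⟩
    have hp := trigData_mem_trigBox (toComplex (γ x)).arg
    have hω := (angularSpeed_mem (hγ.norm_pos x) hp (hw.speed _ ε hx1.le hε _ hp)).1
    have hlip := (hw.isPeriodicLipschitz hε hB).lipschitz (toComplex (γ x)).arg
      ‖toComplex (γ x)‖ (R ((toComplex (γ x)).arg : ℝ))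
    simp only [clamp_of_abs_le hx1.le, clamp_of_abs_le (hRδ _).le] at hlip
    have hlt := lt_of_le_of_lt hlip hx2
    generalize polarSlope f g (trigData (toComplex (γ x)).arg) ‖toComplex (γ x)‖ ε -
      polarSlope f g (trigData (toComplex (γ x)).arg) (R ((toComplex (γ x)).arg : ℝ)) ε = Δ at *
    generalize angularSpeed f g (trigData (toComplex (γ x)).arg) ‖toComplex (γ x)‖ ε = ω at *
    have h1 : 0 < m * (Δ + m) := by
      have h2 : |m * Δ| < m * m := by
        rw [abs_mul, ← abs_mul_abs_self m]
        exact mul_lt_mul_of_pos_left hlt (abs_pos.2 hm)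
      linarith [(abs_lt.1 h2).1]
    have h3 : 0 < ε * ε := mul_self_pos.2 hε0
    calc 0 < ε * ε * ω * (m * (Δ + m)) := by
          have : 0 < ω := by linarith
          positivity
      _ = _ := by ring
  intro h
  exact key t (by rw [h, mul_zero])

/-- A periodic trajectory that stays on the closed curve `r = R(θ)` covers it. -/
theorem IsTrajectory.range_eq_polarCurve (hw : IsWindow f g r₀ δ κ) (hε : |ε| ≤ δ)
    {γ : ℝ → ℝ × ℝ} (hγ : IsTrajectory f g ε γ) {T : ℝ} (hT : 0 < T)
    (hper : Function.Periodic γ T) {R : C(AddCircle (2 * Real.pi), ℝ)}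
    (hRδ : ∀ θ : ℝ, |R θ - r₀| ≤ δ) (hon : ∀ t, radialOffset R (γ t) = 0) :
    Set.range γ = polarCurve R := by
  apply Set.Subset.antisymm
  · rintro _ ⟨t, rfl⟩
    exact mem_polarCurve_of_radialOffset_eq_zero (hon t)
  rintro _ ⟨θ₀, rfl⟩
  by_contra hne
  have hz : Continuous fun t => toComplex (γ t) := continuous_toComplex.comp hγ.continuous
  -- This rotation sends angle `θ₀` to `π`. If the curve's point at angle `θ₀` is missed, the
  -- rotated trajectory avoids the branch cut, and its negated argument is continuous, periodic and
  -- everywhere increasing: a contradiction.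
  let c : ℂ := -Complex.exp (-(θ₀ * Complex.I))
  have hslit : ∀ t, c * toComplex (γ t) ∈ Complex.slitPlane := by
    intro t
    by_contra hns
    have harg : (c * toComplex (γ t)).arg = Real.pi ∨ c * toComplex (γ t) = 0 := by
      by_contra hcon
      push Not at hcon
      exact hns (Complex.mem_slitPlane_iff_arg.2 hcon)
    have hc0 : c ≠ 0 := neg_ne_zero.2 (Complex.exp_ne_zero _)
    have hnorm : ‖c * toComplex (γ t)‖ = ‖toComplex (γ t)‖ := by
      have : ‖Complex.exp (-(θ₀ * Complex.I))‖ = 1 := by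
        rw [← neg_mul, ← Complex.ofReal_neg, Complex.norm_exp_ofReal_mul_I]
      simp [c, this]
    have harg' := harg.resolve_right (mul_ne_zero hc0 (hγ.toComplex_ne_zero t))
    have hpol := Complex.norm_mul_exp_arg_mul_I (c * toComplex (γ t))
    rw [hnorm, harg', Complex.exp_pi_mul_I] at hpol
    have hpt : toComplex (γ t) = ‖toComplex (γ t)‖ * Complex.exp (θ₀ * Complex.I) := by
      have hee : Complex.exp (-(θ₀ * Complex.I)) * Complex.exp (θ₀ * Complex.I) = 1 := by
        rw [← Complex.exp_add, neg_add_cancel, Complex.exp_zero]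
      simp only [c] at hpol
      linear_combination (Complex.exp (θ₀ * Complex.I)) * hpol - toComplex (γ t) * hee
    have hang : (((toComplex (γ t)).arg : ℝ) : AddCircle (2 * Real.pi)) = (θ₀ : ℝ) := by
      have : (((toComplex (γ t)).arg : ℝ) : Real.Angle) = (θ₀ : ℝ) := by
        rw [hpt]
        rw [Complex.arg_real_mul _ (hγ.norm_pos t), Complex.arg_exp_mul_I]
        simp [Real.Angle.coe_toIocMod]
      exact this
    have hrad := sub_eq_zero.1 (hon t)
    rw [hang] at hrad
    refine hne ⟨t, ?_⟩
    change γ t = (R (θ₀ : ℝ) * _, R (θ₀ : ℝ) * _)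
    rw [← hrad]
    refine Prod.ext ?_ ?_
    · have := congrArg Complex.re hpt
      rw [Complex.re_ofReal_mul, Complex.exp_ofReal_mul_I_re] at this
      exact this
    · have := congrArg Complex.im hpt
      rw [Complex.im_ofReal_mul, Complex.exp_ofReal_mul_I_im] at this
      exact this
  have hcont : Continuous fun t => -(c * toComplex (γ t)).arg :=
    continuous_iff_continuousAt.2 fun t =>
      (ContinuousAt.comp (f := fun t => c * toComplex (γ t)) (Complex.continuousAt_arg (hslit t))
        (continuous_const.mul hz).continuousAt).neg
  refine not_periodic_of_forall_eventually_lt hcont hT (fun t => by simp only [hper t])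
    fun t => (eventually_lt_of_deriv_pos hcont.continuousAt ?_).1
  filter_upwards [hγ.eventually_snd_ne_zero t] with s hs
  refine ⟨_, ?_, (hγ.hasDerivAt_arg hs (hslit s)).neg⟩
  rw [neg_neg]
  have hp := trigData_mem_trigBox (toComplex (γ s)).arg
  have hrad : |‖toComplex (γ s)‖ - r₀| ≤ δ := by
    rw [sub_eq_zero.1 (hon s)]; exact hRδ _
  linarith [(angularSpeed_mem (hγ.norm_pos s) hp (hw.speed _ ε hrad hε _ hp)).1]

end Lienard
end

/-! ### From a periodic polar solution to a periodic orbit. -/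

noncomputable section

namespace Lienard

variable {f g : ℝ[X]} {r₀ δ κ ε : ℝ}

/-- The primitive of a `2π`-periodic function with values in `[2/3, 2]`, which is an increasing
bijection of the line. -/
theorem exists_orderIso_primitive {q : ℝ → ℝ} (hq : Measurable q) (h1 : ∀ s, 2 / 3 ≤ q s)
    (h2 : ∀ s, q s ≤ 2) (hper : Function.Periodic q (2 * Real.pi)) :
    ∃ (e : ℝ ≃o ℝ) (P : ℝ), 0 < P ∧ (∀ θ, e (θ + 2 * Real.pi) = e θ + P) ∧
      ∀ θ, ContinuousAt q θ → HasDerivAt e (q θ) θ := by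
  have hi : ∀ a b, IntervalIntegrable q MeasureTheory.volume a b :=
    intervalIntegrable_of_abs_le (M := 2) hq fun s => abs_le.2 ⟨by linarith [h1 s], h2 s⟩
  let F : ℝ → ℝ := fun θ => ∫ s in (0 : ℝ)..θ, q s
  have hsub : ∀ a b, F b - F a = ∫ s in a..b, q s := fun a b =>
    intervalIntegral.integral_interval_sub_left (hi _ _) (hi _ _)
  have hlow : ∀ a b, a ≤ b → 2 / 3 * (b - a) ≤ F b - F a := by
    intro a b hab
    have := intervalIntegral.integral_mono_on hab (intervalIntegrable_const (c := (2 / 3 : ℝ)))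
      (hi a b) fun s _ => h1 s
    rw [intervalIntegral.integral_const, smul_eq_mul] at this
    rw [hsub]
    linarith
  have hmono : StrictMono F := fun a b hab => by
    have := hlow a b hab.le
    linarith
  have hF0 : F 0 = 0 := intervalIntegral.integral_same
  have hcont : Continuous F := intervalIntegral.continuous_primitive hi 0
  have hsurj : Function.Surjective F := by
    refine hcont.surjective ?_ ?_
    · refine tendsto_atTop_mono' _ ?_ (tendsto_id.const_mul_atTop (by norm_num : (0 : ℝ) < 2 / 3))
      filter_upwards [eventually_ge_atTop 0] with x hx
      have := hlow 0 x hx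
      simp only [id]
      linarith
    · refine tendsto_atBot_mono' _ ?_ (tendsto_id.const_mul_atBot (by norm_num : (0 : ℝ) < 2 / 3))
      filter_upwards [eventually_le_atBot 0] with x hx
      have := hlow x 0 hx
      simp only [id]
      linarith
  refine ⟨hmono.orderIsoOfSurjective F hsurj, F (2 * Real.pi), ?_, ?_, ?_⟩
  · have := hmono Real.two_pi_pos
    rwa [hF0] at this
  · intro θ
    change F (θ + 2 * Real.pi) = F θ + F (2 * Real.pi)
    have h3 := hper.intervalIntegral_add_eq θ 0
    have h4 := hsub θ (θ + 2 * Real.pi)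
    rw [h3, zero_add] at h4
    have h5 := hsub 0 (2 * Real.pi)
    linarith
  · intro θ hc
    exact intervalIntegral.integral_hasDerivAt_right (hi 0 θ)
      hq.stronglyMeasurable.stronglyMeasurableAtFilter hc

/-- A periodic solution of the polar equation is a periodic orbit of the system. -/
theorem isPeriodicOrbit_polarCurve (hw : IsWindow f g r₀ δ κ) (hε : |ε| ≤ δ)
    {R : C(AddCircle (2 * Real.pi), ℝ)} (hR : IsPolarSolution f g ε 0 R)
    (hRδ : ∀ θ : ℝ, |R θ - r₀| ≤ δ) : IsPeriodicOrbit f g ε (polarCurve R) := by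
  have hRc : Continuous fun θ : ℝ => R θ := R.continuous.comp (AddCircle.continuous_mk' _)
  have hRper : ∀ θ : ℝ, R ((θ + 2 * Real.pi : ℝ) : AddCircle (2 * Real.pi)) = R θ := fun θ => by
    rw [AddCircle.coe_add_period]
  have hRpos : ∀ θ : ℝ, 0 < R θ := fun θ => hw.radius_pos (hRδ θ)
  let ω : ℝ → ℝ := fun θ => angularSpeed f g (trigData θ) (R θ) ε
  have hω : ∀ θ, 1 / 2 ≤ ω θ ∧ ω θ ≤ 3 / 2 := fun θ =>
    angularSpeed_mem (hRpos θ) (trigData_mem_trigBox θ)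
      (hw.speed _ ε (hRδ θ) hε _ (trigData_mem_trigBox θ))
  have hωm : Measurable ω := by
    have h1 : Measurable fun θ => polarForce f g (trigData θ) (R θ) :=
      (continuous_polarForce f g).measurable.comp (measurable_trigData.prodMk hRc.measurable)
    have h2 := measurable_trigData
    have h3 := hRc.measurable
    simp only [ω, angularSpeed]
    fun_prop
  have hωc : ∀ θ, Real.sin θ ≠ 0 → ContinuousAt ω θ := by
    intro θ hθ
    have h1 := continuousAt_trigData hθ
    have h2 : ContinuousAt (fun θ => polarForce f g (trigData θ) (R θ)) θ :=
      ContinuousAt.comp (f := fun θ : ℝ => (trigData θ, R (θ : AddCircle (2 * Real.pi)))) (x := θ)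
        (continuous_polarForce f g).continuousAt (h1.prodMk hRc.continuousAt)
    exact continuousAt_const.add (((continuousAt_const.mul h1.fst).mul h2).div hRc.continuousAt
      (hRpos θ).ne')
  -- Elapsed time is the primitive of `1/ω` in the angle; `2/3` and `2` are the reciprocals of the
  -- bounds on `ω`. The minus sign in `θ(t) = e⁻¹(-t)` reflects clockwise rotation.
  obtain ⟨e, P, hP, heP, hed⟩ := exists_orderIso_primitive (q := fun θ => (ω θ)⁻¹) hωm.inv
    (fun s => by
      rw [← inv_inv (2 / 3 : ℝ)]
      exact inv_anti₀ (by linarith [hω s]) (by linarith [hω s]))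
    (fun s => by
      rw [← inv_inv (2 : ℝ)]
      exact inv_anti₀ (by norm_num) (by linarith [hω s]))
    (fun θ => by simp only [ω, trigData_add_two_pi, hRper])
  let θ : ℝ → ℝ := fun t => e.symm (-t)
  have hθc : Continuous θ := e.symm.continuous.comp continuous_neg
  have hθP : ∀ t, θ (t + P) = θ t - 2 * Real.pi := by
    intro t
    simp only [θ]
    rw [e.symm_apply_eq]
    have := heP (e.symm (-t) - 2 * Real.pi)
    rw [sub_add_cancel, e.apply_symm_apply] at this
    linarith
  have hθd : ∀ t, Real.sin (θ t) ≠ 0 → HasDerivAt θ (-ω (θ t)) t := by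
    intro t ht
    have h1 := hed (θ t) ((hωc _ ht).inv₀ (by linarith [hω (θ t)]))
    have h2 := HasDerivAt.of_local_left_inverse (f := e) (g := e.symm) (a := -t)
      e.symm.continuous.continuousAt h1 (inv_ne_zero (by linarith [hω (θ t)]))
      (Eventually.of_forall e.apply_symm_apply)
    have h3 := h2.comp t (hasDerivAt_neg t)
    exact h3.congr_deriv (by rw [inv_inv, mul_neg_one])
  let γ : ℝ → ℝ × ℝ := fun t => (R (θ t : ℝ) * Real.cos (θ t), R (θ t : ℝ) * Real.sin (θ t))
  have hsin : ∀ t, (γ t).2 ≠ 0 ↔ Real.sin (θ t) ≠ 0 := fun t => by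
    simp [γ, (hRpos (θ t)).ne']
  refine ⟨γ, ⟨?_, ?_, ?_, ?_⟩, ⟨P, hP, ?_⟩, ?_⟩
  · have := hRc.comp hθc
    exact (this.mul (Real.continuous_cos.comp hθc)).prodMk (this.mul (Real.continuous_sin.comp hθc))
  · intro t ht
    have hs := (hsin t).1 ht
    have h1 := hθd t hs
    have h2 : HasDerivAt (fun t => R ((θ t : ℝ) : AddCircle (2 * Real.pi))) _ t :=
      (hR _ hs).comp t h1
    have h3 := (h2.mul h1.cos).prodMk (h2.mul h1.sin)
    refine h3.congr_deriv ?_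
    have h4 := field_polar f g ε (hRpos (θ t)) (θ t)
    refine Eq.trans ?_ h4.symm
    have h5 := polarSlope_mul_angularSpeed (f := f) (g := g) (ε := ε) (hRpos (θ t))
      (p := trigData (θ t)) (by
        change ω (θ t) ≠ 0
        linarith [hω (θ t)])
    have h6 : R (θ t : ℝ) * ω (θ t) =
        R (θ t : ℝ) + ε * Real.cos (θ t) * polarForce f g (trigData (θ t)) (R (θ t : ℝ)) := by
      have := (hRpos (θ t)).ne'
      simp only [ω, angularSpeed, trigData]
      field_simp
    change _ * ω (θ t) = Real.sin (θ t) * _ at h5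
    have hsc := Real.sin_sq_add_cos_sq (θ t)
    refine Prod.ext ?_ ?_
    · dsimp only
      linear_combination (-ε * Real.cos (θ t)) * h5 + Real.sin (θ t) * h6
    · dsimp only
      linear_combination (-ε * Real.sin (θ t)) * h5 - Real.cos (θ t) * h6 -
        ε * polarForce f g (trigData (θ t)) (R (θ t : ℝ)) * hsc
  · intro t ht
    have hs : Real.sin (θ t) = 0 := by
      by_contra h
      exact (hsin t).2 h ht
    -- The box point has sign coordinate `1`, although `trigData` has `0` here. The speed bound at
    -- it reads `|ε g(x)| ≤ r/2`, while `x² = r²`, so the product `x² - (ε g(x))²` of the vertical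
    -- components is positive.
    have hp : ((Real.cos (θ t), 0, 1) : ℝ × ℝ × ℝ) ∈ trigBox :=
      ⟨Real.cos_mem_Icc _, by simp, by simp⟩
    have h1 := hw.speed _ ε (hRδ (θ t)) hε _ hp
    have hx : (γ t).1 = R (θ t : ℝ) * Real.cos (θ t) := rfl
    have h2 := Real.sin_sq_add_cos_sq (θ t)
    rw [hs] at h2
    refine ⟨ht, ?_⟩
    simp only [upperField, lowerField, ht, hx]
    simp only [polarForce, mul_zero, one_mul, zero_add] at h1
    generalize eval (R (θ t : ℝ) * Real.cos (θ t)) g = y at *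
    have h3 := hRpos (θ t)
    generalize R (θ t : ℝ) = r at *
    have h4 : (ε * y) ^ 2 ≤ (r / 2) ^ 2 := by
      rw [← sq_abs]
      exact pow_le_pow_left₀ (abs_nonneg _) h1 2
    have h5 : (r * Real.cos (θ t)) ^ 2 = r ^ 2 := by
      rw [mul_pow]; linear_combination r ^ 2 * h2
    have h6 : 0 < r ^ 2 := by positivity
    ring_nf at h4 h5 ⊢
    linarith
  · intro t ht
    have hs : Real.sin (θ t) = 0 := by
      by_contra h
      exact (hsin t).2 h ht
    have hcos : Real.cos (θ t) ≠ 0 := by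
      intro h
      have := Real.sin_sq_add_cos_sq (θ t)
      rw [hs, h] at this
      norm_num at this
    have h1 : ∀ᶠ x in 𝓝[≠] (θ t), Real.sin x ≠ 0 :=
      (Real.hasDerivAt_sin (θ t)).eventually_ne hcos
    have h2 : Tendsto θ (𝓝[≠] t) (𝓝[≠] (θ t)) := by
      refine tendsto_nhdsWithin_iff.2
        ⟨hθc.continuousAt.tendsto.mono_left nhdsWithin_le_nhds, ?_⟩
      filter_upwards [self_mem_nhdsWithin] with s hs
      intro h
      exact hs (neg_injective (e.symm.injective h))
    filter_upwards [h2.eventually h1] with s hs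
    exact (hsin s).2 hs
  · intro t
    have h1 : R ((θ t - 2 * Real.pi : ℝ) : AddCircle (2 * Real.pi)) = R (θ t : ℝ) := by
      rw [← hRper, sub_add_cancel]
    simp only [γ, hθP, h1, Real.cos_sub_two_pi, Real.sin_sub_two_pi]
  · ext p
    constructor
    · rintro ⟨φ, rfl⟩
      exact ⟨-e φ, by simp [γ, θ]⟩
    · rintro ⟨t, rfl⟩
      exact ⟨θ t, rfl⟩

end Lienard
end

/-! ### Existence and uniqueness of periodic orbits near a circle. -/

noncomputable section

namespace Lienard

variable {f g : ℝ[X]} {r₀ δ κ ε : ℝ}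

/-- The mean value of the right-hand side of the polar equation along `r = R(θ)`. -/
def slopeMean (f g : ℝ[X]) (ε : ℝ) (R : C(AddCircle (2 * Real.pi), ℝ)) : ℝ :=
  circleMean fun θ => polarSlope f g (trigData θ) (R θ) ε

/-- The closed curves through which the periodic solutions of the polar equation are found: they
start at `R c 0 = c` and solve the polar equation up to the constant `slopeMean`. -/
structure IsCurveFamily (f g : ℝ[X]) (r₀ δ κ B ε : ℝ) (R : ℝ → C(AddCircle (2 * Real.pi), ℝ)) :
    Prop where
  near : ∀ c, |c - r₀| ≤ δ / 2 → ∀ θ : ℝ, |R c θ - c| ≤ 4 * Real.pi * (B + κ) * |ε|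
  lt : ∀ c, |c - r₀| ≤ δ / 2 → ∀ θ : ℝ, |R c θ - r₀| < δ
  solution : ∀ c, |c - r₀| ≤ δ / 2 → IsPolarSolution f g ε (slopeMean f g ε (R c)) (R c)
  lipschitz : ∀ c d, |c - r₀| ≤ δ / 2 → |d - r₀| ≤ δ / 2 → ∀ θ : ℝ,
    |R c θ - R d θ| ≤ 2 * |c - d|
  slopeMean_sub : ∀ c d, |c - r₀| ≤ δ / 2 → |d - r₀| ≤ δ / 2 →
    |slopeMean f g ε (R c) - slopeMean f g ε (R d) - deriv (averagedFunction f g) r₀ * (c - d)| ≤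
      (2 * κ + 8 * Real.pi * |ε| * (B + κ) * B) * |c - d|

theorem IsWindow.intervalIntegrable_slope (hw : IsWindow f g r₀ δ κ) (hε : |ε| ≤ δ)
    {R : C(AddCircle (2 * Real.pi), ℝ)} (hR : ∀ θ : ℝ, |R θ - r₀| ≤ δ) (a b : ℝ) :
    IntervalIntegrable (fun θ : ℝ => polarSlope f g (trigData θ) (R θ) ε)
      MeasureTheory.volume a b := by
  obtain ⟨B, -, hB⟩ := exists_bound_at f g r₀ (hw.pos.trans hw.lt)
  have := (hw.isPeriodicLipschitz hε hB).intervalIntegrable_comp R a b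
  simpa only [clamp_of_abs_le (hR _)] using this

theorem IsWindow.abs_slopeMean_sub_le (hw : IsWindow f g r₀ δ κ) (hε : |ε| ≤ δ)
    {R : C(AddCircle (2 * Real.pi), ℝ)} (hR : ∀ θ : ℝ, |R θ - r₀| ≤ δ) :
    |slopeMean f g ε R - averagedFunction f g r₀| ≤ κ := by
  have h0 : ∀ θ : ℝ, |ContinuousMap.const (AddCircle (2 * Real.pi)) r₀ θ - r₀| ≤ δ := by
    simpa using hw.pos.le
  have h1 := hw.intervalIntegrable_slope (ε := 0) (by simpa using hw.pos.le) h0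
  simp only [ContinuousMap.const_apply] at h1
  rw [averagedFunction_eq_circleMean f g (hw.pos.trans hw.lt), slopeMean,
    ← circleMean_sub (hw.intervalIntegrable_slope hε hR) h1]
  exact abs_circleMean_le fun θ => hw.slope _ ε (hR θ) hε _ (trigData_mem_trigBox θ)

/-- The curves are fixed points for the clamped equation; for small `ε` they stay inside the window,
where the clamp is inactive. -/
theorem IsWindow.exists_curveFamily (hw : IsWindow f g r₀ δ κ) (hε : |ε| ≤ δ) {B : ℝ}
    (hB : ∀ p ∈ trigBox, |polarSlope f g p r₀ 0| ≤ B ∧ |polarSlopeDeriv f g p r₀ 0| ≤ B)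
    (hε1 : 8 * Real.pi * |ε| * (B + κ) ≤ 1) (hε2 : 4 * Real.pi * (B + κ) * |ε| ≤ δ / 4) :
    ∃ R, IsCurveFamily f g r₀ δ κ B ε R := by
  have hQ := hw.isPeriodicLipschitz hε hB
  obtain ⟨R, hR⟩ := hQ.exists_family hε1
  have hδ := hw.pos
  have hnear : ∀ c (θ : ℝ), |R c θ - c| ≤ 4 * Real.pi * (B + κ) * |ε| := fun c θ =>
    hQ.abs_family_sub_le (hR c) θ
  have hlt : ∀ c, |c - r₀| ≤ δ / 2 → ∀ θ : ℝ, |R c θ - r₀| < δ := fun c hc θ => by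
    have := abs_sub_le (R c θ) c r₀
    linarith [hnear c θ]
  have hclamp : ∀ c, |c - r₀| ≤ δ / 2 → (fun s : ℝ =>
      polarSlope f g (trigData s) (clamp r₀ δ (R c s)) ε) =
      fun s : ℝ => polarSlope f g (trigData s) (R c s) ε := fun c hc => by
    ext s; rw [clamp_of_abs_le (hlt c hc s).le]
  have hB0 : 0 ≤ B := (abs_nonneg _).trans (hB _ (trigData_mem_trigBox 0)).1
  refine ⟨R, fun c _ => hnear c, hlt, ?_, fun c d _ _ =>
    (hQ.abs_family_sub_family_le hε1 (hR c) (hR d)).1, ?_⟩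
  · intro c hc θ hθ
    have hRc : Continuous fun θ : ℝ => R c θ := (R c).continuous.comp (AddCircle.continuous_mk' _)
    have hq : ContinuousAt (fun s : ℝ => polarSlope f g (trigData s) (R c s) ε) θ :=
      ContinuousAt.comp
        (f := fun s : ℝ => ((R c (s : AddCircle (2 * Real.pi)), ε), trigData s)) (x := θ)
        (continuousAt_polarSlope f g
          (hw.denom_pos (hlt c hc θ).le hε (trigData_mem_trigBox θ)).ne')
        ((hRc.continuousAt.prodMk continuousAt_const).prodMk (continuousAt_trigData hθ))
    have hm := hQ.measurable_comp (R c)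
    have hi := hQ.intervalIntegrable_comp (R c)
    have he := hR c
    simp only [hclamp c hc] at hm hi he
    have h1 := ((hasDerivAt_oscPrimitive hm hi hq).const_mul ε).const_add c
    exact h1.congr_of_eventuallyEq (Eventually.of_forall he)
  · intro c d hc hd
    have hIc := hw.intervalIntegrable_slope hε fun θ => (hlt c hc θ).le
    have hId := hw.intervalIntegrable_slope hε fun θ => (hlt d hd θ).le
    have hIA : ∀ a b, IntervalIntegrable
        (fun θ => polarSlopeDeriv f g (trigData θ) r₀ 0 * (c - d))
        MeasureTheory.volume a b := fun a b =>
      (intervalIntegrable_of_abs_le (measurable_polarSlopeDeriv_trigData r₀)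
        (fun θ => (hB _ (trigData_mem_trigBox θ)).2) a b).mul_const _
    rw [(hasDerivAt_averagedFunction (hw.pos.trans hw.lt)).deriv, ← circleMean_mul_const,
      slopeMean, slopeMean, ← circleMean_sub hIc hId,
      ← circleMean_sub (fun a b => (hIc a b).sub (hId a b)) hIA]
    refine abs_circleMean_le fun θ => ?_
    have h1 := hw.abs_slope_sub_sub_le (hlt c hc θ).le (hlt d hd θ).le hε (trigData_mem_trigBox θ)
    have h2 := (hB _ (trigData_mem_trigBox θ)).2
    obtain ⟨h3, h4⟩ := hQ.abs_family_sub_family_le hε1 (hR c) (hR d)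
    have h5 : κ * |R c θ - R d θ| ≤ κ * (2 * |c - d|) :=
      mul_le_mul_of_nonneg_left (h3 θ) hw.κ_nonneg
    have h6 : |polarSlopeDeriv f g (trigData θ) r₀ 0 * (R c θ - R d θ - (c - d))| ≤
        B * (8 * Real.pi * |ε| * (B + κ) * |c - d|) := by
      rw [abs_mul]
      exact mul_le_mul h2 (h4 θ) (abs_nonneg _) hB0
    -- The linearization error gives `2κ`; replacing `R c - R d` by `c - d` in the linear term gives
    -- `8π|ε|(B + κ)B`.
    have h7 := abs_add_le (polarSlope f g (trigData θ) (R c θ) ε -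
      polarSlope f g (trigData θ) (R d θ) ε -
        polarSlopeDeriv f g (trigData θ) r₀ 0 * (R c θ - R d θ))
      (polarSlopeDeriv f g (trigData θ) r₀ 0 * (R c θ - R d θ - (c - d)))
    calc _ = _ := by congr 1; ring
      _ ≤ _ := h7
      _ ≤ _ := by linarith

/-- Intermediate value theorem in `c` along a fixed ray: the family sweeps the region between its
extreme curves. -/
theorem IsCurveFamily.exists_radialOffset_eq_zero {B : ℝ}
    {R : ℝ → C(AddCircle (2 * Real.pi), ℝ)} (hδ : 0 < δ) (hF : IsCurveFamily f g r₀ δ κ B ε R)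
    {p : ℝ × ℝ} (h1 : 0 ≤ radialOffset (R (r₀ - δ / 2)) p)
    (h2 : radialOffset (R (r₀ + δ / 2)) p ≤ 0) :
    ∃ c, |c - r₀| ≤ δ / 2 ∧ radialOffset (R c) p = 0 := by
  have hmem : ∀ c ∈ Set.Icc (r₀ - δ / 2) (r₀ + δ / 2), |c - r₀| ≤ δ / 2 := fun c hc =>
    abs_le.2 ⟨by linarith [hc.1], by linarith [hc.2]⟩
  have hcont : ContinuousOn (fun c => R c ((toComplex p).arg : ℝ))
      (Set.Icc (r₀ - δ / 2) (r₀ + δ / 2)) :=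
    (LipschitzOnWith.of_dist_le_mul (K := 2) fun c hc d hd => by
      simpa [Real.dist_eq] using hF.lipschitz c d (hmem c hc) (hmem d hd) _).continuousOn
  obtain ⟨c, hc, h⟩ := intermediate_value_Icc (by linarith) hcont
    (show ‖toComplex p‖ ∈ _ from ⟨by rw [radialOffset] at h1; linarith, by
      rw [radialOffset] at h2; linarith⟩)
  exact ⟨c, hmem c hc, by rw [radialOffset, sub_eq_zero]; exact h.symm⟩

theorem eventually_abs_le {η : ℝ} (hη : 0 < η) (C : ℝ) : ∀ᶠ ε in 𝓝[≠] (0 : ℝ), C * |ε| ≤ η := by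
  have h : Continuous fun ε : ℝ => C * |ε| := by fun_prop
  have := h.continuousAt.eventually_lt_const (show C * |(0 : ℝ)| < η by simpa using hη)
  exact nhdsWithin_le_nhds (this.mono fun ε h => h.le)

/-- The extreme curves start at `r₀ ± δ/2` and deviate by at most `δ/4`, so the annulus of
half-width `δ/4` lies strictly between them. -/
theorem IsCurveFamily.radialOffset_signs {B : ℝ} {R : ℝ → C(AddCircle (2 * Real.pi), ℝ)}
    (hδ : 0 < δ) (hF : IsCurveFamily f g r₀ δ κ B ε R)
    (hε : 4 * Real.pi * (B + κ) * |ε| ≤ δ / 4) {p : ℝ × ℝ} (hp : |‖toComplex p‖ - r₀| < δ / 4) :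
    0 < radialOffset (R (r₀ - δ / 2)) p ∧ radialOffset (R (r₀ + δ / 2)) p < 0 := by
  have h1 := hF.near (r₀ - δ / 2) (by rw [sub_sub_cancel_left, abs_neg, abs_of_pos (by linarith)])
    (toComplex p).arg
  have h2 := hF.near (r₀ + δ / 2) (by rw [add_sub_cancel_left, abs_of_pos (by linarith)])
    (toComplex p).arg
  rw [abs_le] at h1 h2
  rw [abs_lt] at hp
  constructor <;> rw [radialOffset] <;> linarith [h1.2, h2.1, hp.1, hp.2]

/-- No periodic orbit passes near a circle on which the averaged function does not vanish. -/
theorem eventually_no_periodicOrbit (hr₀ : 0 < r₀) (hne : averagedFunction f g r₀ ≠ 0) :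
    ∃ η > 0, ∀ᶠ ε in 𝓝[≠] (0 : ℝ), ∀ Γ, IsPeriodicOrbit f g ε Γ → ∀ p ∈ Γ,
      η ≤ |‖toComplex p‖ - r₀| := by
  obtain ⟨δ₀, hδ₀, hw⟩ := exists_isWindow f g hr₀ (half_pos (abs_pos.2 hne))
  obtain ⟨B, -, hB⟩ := exists_bound_at f g r₀ hr₀
  replace hw := hw (δ₀ / 2) (by positivity) (by linarith)
  set κ := |averagedFunction f g r₀| / 2
  set δ := δ₀ / 2
  have hδ := hw.pos
  refine ⟨δ / 4, by positivity, ?_⟩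
  filter_upwards [self_mem_nhdsWithin, eventually_abs_le hδ 1,
    eventually_abs_le one_pos (8 * Real.pi * (B + κ)),
    eventually_abs_le (by positivity : 0 < δ / 4) (4 * Real.pi * (B + κ))] with ε hε0 hε hε1 hε2
  rw [one_mul] at hε
  obtain ⟨R, hF⟩ := hw.exists_curveFamily hε hB (by linarith) hε2
  rintro _ ⟨γ, hγ, ⟨T, hT, hper⟩, rfl⟩ _ ⟨t, rfl⟩
  by_contra hlt
  obtain ⟨h1, h2⟩ := hF.radialOffset_signs hδ hε2 (not_le.1 hlt)
  obtain ⟨c, hc, h0⟩ := hF.exists_radialOffset_eq_zero hδ h1.le h2.le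
  refine hγ.radialOffset_ne_zero hw hε hε0 hB hT hper ?_ (hF.solution c hc) (hF.lt c hc) t h0
  -- With `κ` half of the averaged value at `r₀`, a vanishing mean would be too far from that value.
  intro hm
  have := hw.abs_slopeMean_sub_le hε fun θ => (hF.lt c hc θ).le
  rw [hm, zero_sub, abs_neg] at this
  have := abs_pos.2 hne
  simp only [κ] at *
  linarith

theorem pos_of_forall_ne_zero {u : ℝ → ℝ} (hu : Continuous u) (h : ∀ t, u t ≠ 0) {t₀ : ℝ}
    (h0 : 0 < u t₀) (t : ℝ) : 0 < u t := by
  by_contra hle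
  obtain ⟨s, hs⟩ := mem_range_of_exists_le_of_exists_ge hu ⟨t, not_lt.1 hle⟩ ⟨t₀, h0.le⟩
  exact h s hs

/-- If the mean vanishes for exactly one curve of the family, then that curve is the only periodic
orbit nearby. -/
theorem IsCurveFamily.eq_polarCurve (hw : IsWindow f g r₀ δ κ) (hε : |ε| ≤ δ) (hε0 : ε ≠ 0)
    {B : ℝ} (hB : ∀ p ∈ trigBox, |polarSlope f g p r₀ 0| ≤ B ∧ |polarSlopeDeriv f g p r₀ 0| ≤ B)
    {R : ℝ → C(AddCircle (2 * Real.pi), ℝ)} (hF : IsCurveFamily f g r₀ δ κ B ε R)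
    (hε2 : 4 * Real.pi * (B + κ) * |ε| ≤ δ / 4) {c : ℝ} (hc : |c - r₀| < δ / 2)
    (huniq : ∀ d, |d - r₀| ≤ δ / 2 → slopeMean f g ε (R d) = 0 → d = c) {Γ : Set (ℝ × ℝ)}
    (hΓ : IsPeriodicOrbit f g ε Γ) {p : ℝ × ℝ} (hp : p ∈ Γ) (hpr : |‖toComplex p‖ - r₀| < δ / 4) :
    Γ = polarCurve (R c) := by
  obtain ⟨γ, hγ, ⟨T, hT, hper⟩, rfl⟩ := hΓ
  obtain ⟨t₀, rfl⟩ := hp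
  have hδ := hw.pos
  obtain ⟨h1, h2⟩ := hF.radialOffset_signs hδ hε2 hpr
  have havoid : ∀ d, |d - r₀| ≤ δ / 2 → d ≠ c → ∀ t, radialOffset (R d) (γ t) ≠ 0 :=
    fun d hd hdc => hγ.radialOffset_ne_zero hw hε hε0 hB hT hper
      (fun hm => hdc (huniq d hd hm)) (hF.solution d hd) (hF.lt d hd)
  rw [abs_lt] at hc
  -- The extreme curves are not the curve `c`, so they are barriers and confine the whole orbit.
  -- Each of its points then lies on some curve of the family, which can only be `c`.
  have hlow := pos_of_forall_ne_zero (hγ.continuous_radialOffset (R (r₀ - δ / 2)))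
    (havoid _ (by rw [sub_sub_cancel_left, abs_neg, abs_of_pos (by linarith)])
      (by rintro rfl; linarith)) h1
  have hhigh := pos_of_forall_ne_zero (hγ.continuous_radialOffset (R (r₀ + δ / 2))).neg
    (fun t => neg_ne_zero.2 (havoid _ (by rw [add_sub_cancel_left, abs_of_pos (by linarith)])
      (by rintro rfl; linarith) t)) (neg_pos.2 h2)
  refine hγ.range_eq_polarCurve hw hε hT hper
    (fun θ => (hF.lt c (abs_lt.2 hc).le θ).le) fun t => ?_
  obtain ⟨d, hd, h0⟩ := hF.exists_radialOffset_eq_zero hδ (hlow t).le (neg_pos.1 (hhigh t)).le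
  by_cases hdc : d = c
  · rwa [← hdc]
  · exact absurd h0 (havoid d hd hdc t)

/-- Near a simple zero of the averaged function there is exactly one periodic orbit. -/
theorem exists_unique_periodicOrbit (hr₀ : 0 < r₀) (h0 : averagedFunction f g r₀ = 0)
    (hne : deriv (averagedFunction f g) r₀ ≠ 0) :
    ∃ η₀ > 0, ∀ η > 0, ∀ᶠ ε in 𝓝[≠] (0 : ℝ), ∃ R : C(AddCircle (2 * Real.pi), ℝ),
      (∀ θ : ℝ, |R θ - r₀| < η) ∧ IsPeriodicOrbit f g ε (polarCurve R) ∧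
      ∀ Γ, IsPeriodicOrbit f g ε Γ → ∀ p ∈ Γ, |‖toComplex p‖ - r₀| < η₀ → Γ = polarCurve R := by
  set D := deriv (averagedFunction f g) r₀
  have hD := abs_pos.2 hne
  -- With `κ = |D|/8` and the `ε` term at most `|D|/4`, the nonlinear error in `m` is at most half
  -- its linear part; hence zeros of `m` are unique.
  obtain ⟨δ₀, hδ₀, hw⟩ := exists_isWindow f g hr₀ (by positivity : 0 < |D| / 8)
  obtain ⟨B, -, hB⟩ := exists_bound_at f g r₀ hr₀
  replace hw := hw (δ₀ / 2) (by positivity) (by linarith)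
  set κ := |D| / 8 with hκ
  set δ := δ₀ / 2
  have hδ := hw.pos
  refine ⟨δ / 4, by positivity, fun η hη => ?_⟩
  obtain ⟨η', hη', hη'η, hη'δ⟩ : ∃ η' > 0, η' ≤ η / 2 ∧ η' ≤ δ / 4 :=
    ⟨min (η / 2) (δ / 4), by positivity, min_le_left _ _, min_le_right _ _⟩
  -- A second window, depending on `η`, only makes `m r₀` small; the first one fixes `η₀`, which
  -- must not depend on `η`.
  obtain ⟨δ₁, hδ₁, hw'⟩ := exists_isWindow f g hr₀ (by positivity : 0 < |D| * η' / 4)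
  replace hw' := hw' (δ₁ / 2) (by positivity) (by linarith)
  filter_upwards [self_mem_nhdsWithin, eventually_abs_le hδ 1, eventually_abs_le hw'.pos 1,
    eventually_abs_le one_pos (8 * Real.pi * (B + κ)),
    eventually_abs_le (by positivity : 0 < δ / 4) (4 * Real.pi * (B + κ)),
    eventually_abs_le hw'.pos (4 * Real.pi * (B + κ)),
    eventually_abs_le (by positivity : 0 < η / 4) (4 * Real.pi * (B + κ)),
    eventually_abs_le (by positivity : 0 < |D| / 4) (8 * Real.pi * (B + κ) * B)]
    with ε hε0 hε hε' hε1 hε2 hε3 hε4 hε5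
  rw [one_mul] at hε hε'
  obtain ⟨R, hF⟩ := hw.exists_curveFamily hε hB (by linarith) hε2
  let m : ℝ → ℝ := fun c => slopeMean f g ε (R c)
  have hm : ∀ c d, |c - r₀| ≤ δ / 2 → |d - r₀| ≤ δ / 2 →
      |m c - m d - D * (c - d)| ≤ |D| / 2 * |c - d| := fun c d hc hd =>
    (hF.slopeMean_sub c d hc hd).trans
      (mul_le_mul_of_nonneg_right (by linarith) (abs_nonneg _))
  have hr : |r₀ - r₀| ≤ δ / 2 := by rw [sub_self, abs_zero]; positivity
  have hm0 : |m r₀| ≤ |D| * η' / 4 := by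
    have := hw'.abs_slopeMean_sub_le hε' (R := R r₀) fun θ => (hF.near r₀ hr θ).trans hε3
    rwa [h0, sub_zero] at this
  have hsign : ∀ s, |s| = η' → |m (r₀ + s) - D * s| ≤ |D| * η' * (3 / 4) := by
    intro s hs
    have h1 := hm (r₀ + s) r₀ (by rw [add_sub_cancel_left, hs]; linarith) hr
    rw [add_sub_cancel_left, hs] at h1
    have h2 := abs_add_le (m (r₀ + s) - m r₀ - D * s) (m r₀)
    rw [show m (r₀ + s) - m r₀ - D * s + m r₀ = m (r₀ + s) - D * s by ring] at h2
    linarith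
  obtain ⟨c, hc, hmc⟩ : ∃ c, |c - r₀| ≤ η' ∧ m c = 0 := by
    have hmem : ∀ c ∈ Set.Icc (r₀ - η') (r₀ + η'), |c - r₀| ≤ η' := fun c hc =>
      abs_le.2 ⟨by linarith [hc.1], by linarith [hc.2]⟩
    -- Multiplying by `D` treats both signs of the derivative at once: `D * m` is negative at `r₀ -
    -- η'` and positive at `r₀ + η'`.
    have hcont : ContinuousOn (fun c => D * m c) (Set.Icc (r₀ - η') (r₀ + η')) := by
      refine continuousOn_const.mul (LipschitzOnWith.of_dist_le_mul
        (K := (|D| * (3 / 2)).toNNReal) fun c hc d hd => ?_).continuousOn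
      have h1 := hm c d (by linarith [hmem c hc]) (by linarith [hmem d hd])
      have h2 := abs_add_le (m c - m d - D * (c - d)) (D * (c - d))
      rw [sub_add_cancel, abs_mul] at h2
      rw [Real.dist_eq, Real.dist_eq, Real.coe_toNNReal _ (by positivity)]
      linarith
    have hDD : 0 < |D| * |D| := mul_pos hD hD
    have hbound : ∀ s, |s| = η' → |D * m (r₀ + s) - D * D * s| ≤ |D| * |D| * η' * (3 / 4) := by
      intro s hs
      have := mul_le_mul_of_nonneg_left (hsign s hs) hD.le
      rw [← abs_mul, mul_sub, ← mul_assoc] at this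
      linarith
    have hplus := (abs_le.1 (hbound η' (abs_of_pos hη'))).1
    have hminus := (abs_le.1 (hbound (-η') (by rw [abs_neg, abs_of_pos hη']))).2
    rw [abs_mul_abs_self] at hplus hminus hDD
    have hpos : 0 < D * D * η' := mul_pos hDD hη'
    obtain ⟨c, hc, h⟩ := intermediate_value_Icc (by linarith) hcont
      (show (0 : ℝ) ∈ _ from ⟨by rw [sub_eq_add_neg]; linarith, by linarith⟩)
    exact ⟨c, hmem c hc, (mul_eq_zero.1 h).resolve_left hne⟩
  have hcδ : |c - r₀| < δ / 2 := by linarith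
  refine ⟨R c, fun θ => ?_, ?_, fun Γ hΓ p hp hpr => ?_⟩
  · have h1 := abs_sub_le (R c θ) c r₀
    linarith [hF.near c hcδ.le θ]
  · refine isPeriodicOrbit_polarCurve hw hε ?_ fun θ => (hF.lt c hcδ.le θ).le
    have := hF.solution c hcδ.le
    rwa [show slopeMean f g ε (R c) = 0 from hmc] at this
  · refine hF.eq_polarCurve hw hε hε0 hB hε2 hcδ (fun d hd hmd => ?_) hΓ hp hpr
    have h1 := hm d c hd hcδ.le
    rw [hmc, show m d = 0 from hmd, sub_zero, zero_sub, abs_neg, abs_mul] at h1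
    by_contra hdc
    have h2 := mul_pos hD (abs_pos.2 (sub_ne_zero.2 hdc))
    linarith

end Lienard
end

/-! ### Hausdorff convergence, compactness and the exact count. -/

noncomputable section

namespace Lienard

variable {f g : ℝ[X]}

theorem toComplex_polar (r θ : ℝ) :
    ‖toComplex (r * Real.cos θ, r * Real.sin θ)‖ = |r| := by
  have h := norm_toComplex_sq (r * Real.cos θ, r * Real.sin θ)
  have h2 : ‖toComplex (r * Real.cos θ, r * Real.sin θ)‖ ^ 2 = r ^ 2 := by
    rw [h]; linear_combination r ^ 2 * Real.sin_sq_add_cos_sq θ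
  rw [← abs_norm]
  exact (sq_eq_sq_iff_abs_eq_abs _ _).1 h2

theorem edist_polar_le (r s θ : ℝ) :
    edist (r * Real.cos θ, r * Real.sin θ) (s * Real.cos θ, s * Real.sin θ) ≤
      ENNReal.ofReal |r - s| := by
  rw [edist_dist]
  refine ENNReal.ofReal_le_ofReal ?_
  rw [Prod.dist_eq, Real.dist_eq, Real.dist_eq, ← sub_mul, ← sub_mul, abs_mul, abs_mul]
  exact max_le (mul_le_of_le_one_right (abs_nonneg _) (Real.abs_cos_le_one _))
    (mul_le_of_le_one_right (abs_nonneg _) (Real.abs_sin_le_one _))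

/-- Points of the curve and the circle are matched along rays. -/
theorem hausdorffEDist_polarCurve_le {R : C(AddCircle (2 * Real.pi), ℝ)} {r η : ℝ} (hr : 0 < r)
    (hR : ∀ θ : ℝ, |R θ - r| < η) :
    Metric.hausdorffEDist (polarCurve R) (centerOrbit r) ≤ ENNReal.ofReal η := by
  refine Metric.hausdorffEDist_le_of_mem_edist ?_ ?_
  · rintro _ ⟨θ, rfl⟩
    refine ⟨(r * Real.cos θ, r * Real.sin θ), ?_,
      (edist_polar_le _ _ _).trans (ENNReal.ofReal_le_ofReal (hR θ).le)⟩
    change (r * Real.cos θ) ^ 2 + (r * Real.sin θ) ^ 2 = r ^ 2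
    linear_combination r ^ 2 * Real.sin_sq_add_cos_sq θ
  · intro p hp
    have hn : ‖toComplex p‖ = r := by
      have := norm_toComplex_sq p
      rw [show p.1 ^ 2 + p.2 ^ 2 = r ^ 2 from hp] at this
      exact (sq_eq_sq₀ (norm_nonneg _) hr.le).1 this
    have hpp : p = (r * Real.cos (toComplex p).arg, r * Real.sin (toComplex p).arg) := by
      conv_lhs => rw [show p = (p.1, p.2) from rfl, fst_eq_polar p, snd_eq_polar p, hn]
    refine ⟨_, ⟨(toComplex p).arg, rfl⟩, ?_⟩
    have h := edist_polar_le (R ((toComplex p).arg : ℝ)) r (toComplex p).arg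
    rw [← hpp] at h
    rw [edist_comm]
    exact h.trans (ENNReal.ofReal_le_ofReal (hR _).le)

/-- The periodic orbits of the system near simple zeros of the averaged function. -/
theorem exists_family_near {r₀ : ℝ} (hr₀ : 0 < r₀) (h0 : averagedFunction f g r₀ = 0)
    (hne : deriv (averagedFunction f g) r₀ ≠ 0) :
    ∃ η₀ > 0, ∃ Γ : ℝ → Set (ℝ × ℝ),
      (∀ᶠ ε in 𝓝[≠] (0 : ℝ), IsPeriodicOrbit f g ε (Γ ε) ∧ ∀ Γ', IsPeriodicOrbit f g ε Γ' →
        ∀ p ∈ Γ', |‖toComplex p‖ - r₀| < η₀ → Γ' = Γ ε) ∧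
      ∀ η > 0, ∀ᶠ ε in 𝓝[≠] (0 : ℝ), ∃ R : C(AddCircle (2 * Real.pi), ℝ),
        (∀ θ : ℝ, |R θ - r₀| < η) ∧ Γ ε = polarCurve R := by
  classical
  obtain ⟨η₀, hη₀, H⟩ := exists_unique_periodicOrbit hr₀ h0 hne
  let P : ℝ → Set (ℝ × ℝ) → Prop := fun ε G =>
    IsPeriodicOrbit f g ε G ∧ ∃ p ∈ G, |‖toComplex p‖ - r₀| < η₀
  -- The choice refers only to `η₀`, so by local uniqueness one family serves every `η`.
  let Γ : ℝ → Set (ℝ × ℝ) := fun ε => if h : ∃ G, P ε G then h.choose else ∅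
  have key : ∀ η > 0, ∀ᶠ ε in 𝓝[≠] (0 : ℝ), ∃ R : C(AddCircle (2 * Real.pi), ℝ),
      (∀ θ : ℝ, |R θ - r₀| < η) ∧ Γ ε = polarCurve R ∧ IsPeriodicOrbit f g ε (polarCurve R) ∧
      ∀ Γ', IsPeriodicOrbit f g ε Γ' → ∀ p ∈ Γ', |‖toComplex p‖ - r₀| < η₀ →
        Γ' = polarCurve R := by
    intro η hη
    filter_upwards [H (min (min η η₀) r₀) (lt_min (lt_min hη hη₀) hr₀)] with ε hε
    obtain ⟨R, hR, hper, huniq⟩ := hε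
    have hP : P ε (polarCurve R) := by
      refine ⟨hper, _, ⟨0, rfl⟩, ?_⟩
      have h1 := (hR 0).trans_le (min_le_right _ _)
      have h2 : 0 < R ((0 : ℝ) : AddCircle (2 * Real.pi)) := by linarith [(abs_lt.1 h1).1]
      rw [toComplex_polar, abs_of_pos h2]
      exact (hR 0).trans_le ((min_le_left _ _).trans (min_le_right _ _))
    have hex : ∃ G, P ε G := ⟨_, hP⟩
    refine ⟨R, fun θ => (hR θ).trans_le ((min_le_left _ _).trans (min_le_left _ _)), ?_, hper,
      huniq⟩
    simp only [Γ, dif_pos hex]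
    obtain ⟨h1, p, hp, hpr⟩ := hex.choose_spec
    exact huniq _ h1 p hp hpr
  refine ⟨η₀, hη₀, Γ, ?_, fun η hη => (key η hη).mono fun ε ⟨R, h1, h2, _⟩ => ⟨R, h1, h2⟩⟩
  filter_upwards [key 1 one_pos] with ε ⟨R, _, h2, h3, h4⟩
  rw [h2]
  exact ⟨h3, h4⟩

theorem nonempty_of_isPeriodicOrbit {ε : ℝ} {Γ : Set (ℝ × ℝ)} (h : IsPeriodicOrbit f g ε Γ) :
    Γ.Nonempty := by
  obtain ⟨γ, -, -, rfl⟩ := h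
  exact Set.range_nonempty γ

/-- If all positive zeros of the averaged function are simple, then they are exactly the radii of
the circles from which limit cycles bifurcate, one from each circle. -/
theorem bifurcateExactlyFrom_of_simple_zeros {k : ℕ} {r : Fin k → ℝ} (hmono : StrictMono r)
    (hpos : ∀ i, 0 < r i) (hzeros : averagedZeros f g = Set.range r)
    (hsimple : ∀ i, deriv (averagedFunction f g) (r i) ≠ 0) : BifurcateExactlyFrom f g r := by
  have hzero : ∀ i, averagedFunction f g (r i) = 0 := fun i =>
    (hzeros.symm ▸ Set.mem_range_self i : r i ∈ averagedZeros f g).2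
  choose η hη Γ huniq hnear using fun i => exists_family_near (hpos i) (hzero i) (hsimple i)
  refine ⟨hmono, hpos, fun ε i => Γ i ε, fun i => ?_, fun a b ha hab hr => ?_⟩
  · rw [ENNReal.tendsto_nhds_zero]
    intro e he
    obtain ⟨x, hx0, hxe⟩ := ENNReal.lt_iff_exists_nnreal_btwn.1 he
    filter_upwards [hnear i x (by exact_mod_cast hx0)] with ε ⟨R, hR, hΓ⟩
    rw [hΓ]
    refine (hausdorffEDist_polarCurve_le (hpos i) hR).trans ?_
    rw [ENNReal.ofReal_coe_nnreal]
    exact hxe.le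
  have hsep : ∀ᶠ ε in 𝓝[≠] (0 : ℝ), ∀ i j, i ≠ j → Γ i ε ≠ Γ j ε := by
    refine eventually_all.2 fun i => eventually_all.2 fun j => ?_
    by_cases hij : i = j
    · exact Eventually.of_forall fun ε h => absurd hij h
    have hd : 0 < |r i - r j| / 2 := half_pos (abs_pos.2 (sub_ne_zero.2 (hmono.injective.ne hij)))
    filter_upwards [hnear i (min (|r i - r j| / 2) (r i)) (lt_min hd (hpos i)),
      hnear j (min (|r i - r j| / 2) (r j)) (lt_min hd (hpos j))] with ε ⟨R, hR, hi⟩ ⟨S, hS, hj⟩ _ heq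
    rw [hi, hj] at heq
    obtain ⟨θ, hθ⟩ : (R (0 : ℝ) * Real.cos 0, R (0 : ℝ) * Real.sin 0) ∈ polarCurve S :=
      heq ▸ ⟨0, rfl⟩
    have h1 := congrArg (fun p => ‖toComplex p‖) hθ
    simp only [toComplex_polar] at h1
    have h2 := (hR 0).trans_le (min_le_right _ _)
    have h3 := (hS θ).trans_le (min_le_right _ _)
    have hR0 : 0 < R ((0 : ℝ) : AddCircle (2 * Real.pi)) := by linarith [(abs_lt.1 h2).1]
    have hS0 : 0 < S (θ : AddCircle (2 * Real.pi)) := by linarith [(abs_lt.1 h3).1]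
    rw [abs_of_pos hR0, abs_of_pos hS0] at h1
    have h4 := (hR 0).trans_le (min_le_left _ _)
    have h5 := (hS θ).trans_le (min_le_left _ _)
    rw [h1] at h5
    have h6 := abs_sub_le (r i) (R (0 : ℝ)) (r j)
    rw [abs_sub_comm (r i) (R (0 : ℝ))] at h6
    linarith
  have hcover : ∀ᶠ ε in 𝓝[≠] (0 : ℝ), ∀ Γ', IsPeriodicOrbit f g ε Γ' → ∀ p ∈ Γ',
      ‖toComplex p‖ ∈ Set.Icc a b → ∃ i, Γ' = Γ i ε := by
    -- Each radius in `[a, b]` has a neighbourhood where orbits are accounted for: by uniqueness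
    -- near a zero, by absence elsewhere. Compactness yields a common range of `ε`.
    refine isCompact_Icc.induction_on (p := fun s => ∀ᶠ ε in 𝓝[≠] (0 : ℝ), ∀ Γ',
      IsPeriodicOrbit f g ε Γ' → ∀ p ∈ Γ', ‖toComplex p‖ ∈ s → ∃ i, Γ' = Γ i ε) ?_ ?_ ?_ ?_
    · exact Eventually.of_forall fun ε Γ' _ p _ h => absurd h (Set.notMem_empty _)
    · exact fun s t hst ht => ht.mono fun ε h Γ' hΓ' p hp hs => h Γ' hΓ' p hp (hst hs)
    · intro s t hs ht
      filter_upwards [hs, ht] with ε h1 h2 Γ' hΓ' p hp hst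
      exact hst.elim (h1 Γ' hΓ' p hp) (h2 Γ' hΓ' p hp)
    · intro x hx
      have hx0 : 0 < x := ha.trans_le hx.1
      have hball : ∀ η > 0, {y : ℝ | |y - x| < η} ∈ 𝓝[Set.Icc a b] x := fun η hη =>
        nhdsWithin_le_nhds (Metric.ball_mem_nhds x hη)
      by_cases h0 : averagedFunction f g x = 0
      · obtain ⟨i, rfl⟩ : x ∈ Set.range r := hzeros ▸ ⟨hx0, h0⟩
        exact ⟨_, hball _ (hη i), (huniq i).mono fun ε h Γ' hΓ' p hp hpr =>
          ⟨i, h.2 Γ' hΓ' p hp hpr⟩⟩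
      · obtain ⟨η', hη', h⟩ := eventually_no_periodicOrbit hx0 h0
        exact ⟨_, hball _ hη', h.mono fun ε h Γ' hΓ' p hp hpr =>
          absurd hpr (not_lt.2 (h Γ' hΓ' p hp))⟩
  have hinside : ∀ᶠ ε in 𝓝[≠] (0 : ℝ), ∀ i, ∃ R : C(AddCircle (2 * Real.pi), ℝ),
      (∀ θ : ℝ, |R θ - r i| < min (η i) (min (r i - a) (b - r i))) ∧ Γ i ε = polarCurve R :=
    eventually_all.2 fun i => hnear i _
      (lt_min (hη i) (lt_min (sub_pos.2 (hr i).1) (sub_pos.2 (hr i).2)))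
  filter_upwards [hsep, hcover, hinside, eventually_all.2 huniq] with ε hsep hcover hinside huniq
  refine ⟨fun i j hij => by_contra fun h => hsep i j h hij, Set.Subset.antisymm ?_ ?_⟩
  · rintro Γ' ⟨⟨hΓ', -⟩, hsub⟩
    obtain ⟨p, hp⟩ := nonempty_of_isPeriodicOrbit hΓ'
    obtain ⟨h1, h2⟩ := hsub hp
    rw [← norm_toComplex_sq] at h1 h2
    obtain ⟨i, rfl⟩ := hcover Γ' hΓ' p hp ⟨le_of_sq_le_sq h1 (norm_nonneg _),
      le_of_sq_le_sq h2 (ha.trans hab).le⟩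
    exact ⟨i, rfl⟩
  · rintro _ ⟨i, rfl⟩
    obtain ⟨hper, hu⟩ := huniq i
    obtain ⟨R, hR, hΓ⟩ := hinside i
    have hR1 : ∀ θ : ℝ, |R θ - r i| < η i := fun θ => (hR θ).trans_le (min_le_left _ _)
    have hR2 : ∀ θ : ℝ, a < R θ ∧ R θ < b := fun θ => by
      have h1 := abs_lt.1 ((hR θ).trans_le ((min_le_right _ _).trans (min_le_left _ _)))
      have h2 := abs_lt.1 ((hR θ).trans_le ((min_le_right _ _).trans (min_le_right _ _)))
      constructor <;> linarith [h1.1, h2.2]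
    have hnorm : ∀ p ∈ Γ i ε, ∃ θ : ℝ, ‖toComplex p‖ = R θ := by
      intro p hp
      rw [hΓ] at hp
      obtain ⟨θ, rfl⟩ := hp
      exact ⟨θ, by rw [toComplex_polar, abs_of_pos (ha.trans (hR2 θ).1)]⟩
    -- The local uniqueness region is itself the isolating neighbourhood that makes the orbit a
    -- limit cycle.
    refine ⟨⟨hper, {p | |‖toComplex p‖ - r i| < η i}, ?_, ?_, ?_⟩, ?_⟩
    · exact isOpen_lt ((continuous_toComplex.norm.sub continuous_const).abs) continuous_const
    · intro p hp
      obtain ⟨θ, hθ⟩ := hnorm p hp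
      change |‖toComplex p‖ - r i| < η i
      rw [hθ]
      exact hR1 θ
    · rintro Γ' hΓ' ⟨p, hp, hpr⟩
      exact hu Γ' hΓ' p hp hpr
    · intro p hp
      obtain ⟨θ, hθ⟩ := hnorm p hp
      have h3 := hR2 θ
      change a ^ 2 ≤ p.1 ^ 2 + p.2 ^ 2 ∧ p.1 ^ 2 + p.2 ^ 2 ≤ b ^ 2
      rw [← norm_toComplex_sq, hθ]
      exact ⟨pow_le_pow_left₀ ha.le h3.1.le 2,
        pow_le_pow_left₀ (ha.trans h3.1).le h3.2.le 2⟩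

/-- One annulus containing all the circles in its interior suffices; `k + 1` guarantees a smallest
and a largest radius from which to build it. -/
theorem BifurcateExactlyFrom.le_bifurcationNumber {k : ℕ} {r : Fin (k + 1) → ℝ}
    (h : BifurcateExactlyFrom f g r) : ((k + 1 : ℕ) : ℕ∞) ≤ bifurcationNumber f g := by
  obtain ⟨hmono, hpos, Γ, -, hΓ⟩ := h
  have h0 := hpos 0
  have ha : ∀ i, r 0 / 2 < r i := fun i =>
    (half_lt_self h0).trans_le (hmono.monotone (Fin.zero_le i))
  have hb : ∀ i, r i < r (Fin.last k) + 1 := fun i =>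
    (hmono.monotone (Fin.le_last i)).trans_lt (lt_add_one _)
  refine le_trans ?_ (le_iSup₂_of_le (r 0 / 2) (r (Fin.last k) + 1)
    (le_iSup₂_of_le (half_pos h0) ((ha 0).trans (hb 0)) le_rfl))
  refine le_liminf_of_le (by isBoundedDefault) ?_
  filter_upwards [hΓ _ _ (half_pos h0) ((ha 0).trans (hb 0)) fun i => ⟨ha i, hb i⟩]
    with ε ⟨hinj, heq⟩
  rw [heq, ← Set.image_univ, hinj.encard_image, Set.encard_univ]
  simp

end Lienard
end

theorem mainTheorem1 (n m : ℕ) (hn : 1 ≤ n) (hm : 1 ≤ m) :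
    ((n / 2 + m / 2 + 1 : ℕ) : ℕ∞) ≤ Lienard.maxBifurcationNumber n m ∧
    (∃ f g : Polynomial ℝ, f.natDegree = n ∧ g.natDegree = m ∧
      ∃ r : Fin (n / 2 + m / 2 + 1) → ℝ,
        Lienard.averagedZeros f g = Set.range r ∧
        (∀ i, deriv (Lienard.averagedFunction f g) (r i) ≠ 0) ∧
        Lienard.BifurcateExactlyFrom f g r) ∧
    (∀ f g : Polynomial ℝ, f.natDegree = n → g.natDegree = m →
      (∃ ρ : ℝ, 0 < ρ ∧ Lienard.averagedFunction f g ρ ≠ 0) →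
      (Lienard.averagedZeros f g).encard ≤ ((n / 2 + m / 2 + 1 : ℕ) : ℕ∞)) := by
  obtain ⟨f, g, hf, hg, r, hmono, hpos, hzeros, hsimple⟩ := Lienard.exists_averagedZeros_eq n m
  have hbif := Lienard.bifurcateExactlyFrom_of_simple_zeros hmono hpos hzeros hsimple
  refine ⟨?_, ⟨f, g, hf, hg, r, hzeros, hsimple, hbif⟩, ?_⟩
  · exact hbif.le_bifurcationNumber.trans
      (le_iSup₂_of_le f g (le_iSup₂_of_le hf hg le_rfl))
  · rintro f g rfl rfl h
    exact Lienard.encard_averagedZeros_le f g h
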